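/- Let $p$ be a probability law on $\{0,1,2,\dots\}$ with mean $m=\sum_n n\,p(n)$ satisfying $1<m<\infty$, and let $\mathcal G$ be the Galton–Watson tree with root $\rho$ in which the numbers of children of the individuals are i.i.d. with law $p$. Fix $\delta>0$. Given $\mathcal G$, let $\mathbf X=(X_k)_{k\ge 0}$ be the once-reinforced random walk on $\mathcal G$ with parameter $\delta$: $X_0=\rho$; every edge initially has weight $1$, and from the first time it is traversed (in either direction) its weight is $\delta$ forever; given $\mathcal G$ and $X_0,\dots,X_k$, the walk jumps from $X_k$ to a neighbour of $X_k$ with probability proportional to the current weight of the connecting edge (if $\rho$ has no children, the walk stays at $\rho$). Then $\mathbf X$ is transient, that is, with positive probability (under the joint law of $\mathcal G$ and $\mathbf X$) it never returns to its starting point: $$\mathbf P\bigl(X_k\neq\rho\ \text{ for all } k\ge 1\bigr)>0 .$$ -/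

import Mathlib

open MeasureTheory ProbabilityTheory
open scoped ENNReal

noncomputable section

/-! ### Once-reinforced random walk on a locally finite graph -/

section OnceReinforced

variable {V : Type*}

/-- A finite trajectory `x_0, …, x_k` of a process with values in `V`. -/
abbrev History (V : Type*) (k : ℕ) : Type _ := (_ : Finset.Iic k) → V

/-- The position `x_j` of the trajectory `x_0, …, x_k` at a time `j ≤ k`. -/
def History.pos {k : ℕ} (h : History V k) (j : ℕ) (hj : j ≤ k) : V := h ⟨j, Finset.mem_Iic.2 hj⟩

/-- The edge `{u, v}` is traversed, in one of the two directions, by one of the jumps of the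
trajectory `x_0, …, x_k`. -/
def History.Traversed {k : ℕ} (h : History V k) (u v : V) : Prop :=
  ∃ (j : ℕ) (hj : j < k),
    (h.pos j hj.le = u ∧ h.pos (j + 1) hj = v) ∨ (h.pos j hj.le = v ∧ h.pos (j + 1) hj = u)

open Classical in
/-- The weight, after the trajectory `x_0, …, x_k`, of the connection between `u` and `v`: `0` if
`u` and `v` are not neighbours, and otherwise `δ` or `1` according to whether the edge `{u, v}` has
been traversed or not. -/
def edgeWeight (δ : ℝ) (G : SimpleGraph V) {k : ℕ} (h : History V k) (u v : V) : ℝ≥0∞ :=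
  if G.Adj u v then (if h.Traversed u v then ENNReal.ofReal δ else 1) else 0

open Classical in
/-- The law of `X_{k+1}` given the trajectory `x_0, …, x_k`: the walk jumps from `x_k` to a
neighbour with probability proportional to the weight of the connecting edge. For a locally finite
graph and `δ > 0`, the total weight at `x_k` is always finite, and it is zero only if `x_k` has no
neighbour at all; in that case the walk stays where it is. -/
def orrwStep (δ : ℝ) (G : SimpleGraph V) (k : ℕ) (h : History V k) : PMF V :=
  if hw : (∑' v, edgeWeight δ G h (h.pos k le_rfl) v) ≠ 0 ∧
      (∑' v, edgeWeight δ G h (h.pos k le_rfl) v) ≠ ∞ then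
    PMF.normalize (edgeWeight δ G h (h.pos k le_rfl)) hw.1 hw.2
  else PMF.pure (h.pos k le_rfl)

variable [MeasurableSpace V] [Countable V] [DiscreteMeasurableSpace V]

/-- The one-step transition kernels of the once-reinforced random walk, from trajectories up to
time `k` to the position at time `k + 1`. -/
def orrwKernel (δ : ℝ) (G : SimpleGraph V) (k : ℕ) : Kernel (History V k) V :=
  Kernel.ofFunOfCountable fun h => (orrwStep δ G k h).toMeasure

instance (δ : ℝ) (G : SimpleGraph V) (k : ℕ) : IsMarkovKernel (orrwKernel δ G k) :=
  ⟨fun h => inferInstanceAs (IsProbabilityMeasure (orrwStep δ G k h).toMeasure)⟩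

/-- The law, on the space `ℕ → V` of infinite trajectories, of the once-reinforced random walk on
the graph `G` with parameter `δ` started from `ρ`. -/
def orrwLaw (δ : ℝ) (G : SimpleGraph V) (ρ : V) : Measure (ℕ → V) :=
  Kernel.traj (X := fun _ => V) (orrwKernel δ G) 0 (fun _ => ρ)

instance (δ : ℝ) (G : SimpleGraph V) (ρ : V) : IsProbabilityMeasure (orrwLaw δ G ρ) :=
  inferInstanceAs (IsProbabilityMeasure
    (Kernel.traj (X := fun _ => V) (orrwKernel δ G) 0 (fun _ => ρ)))

/-- For a graph that depends measurably on a parameter, so does the one-step law of the walk. -/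
theorem measurable_orrwStep {E : Type*} [MeasurableSpace E] (δ : ℝ) (G : E → SimpleGraph V)
    (hG : ∀ u v, MeasurableSet {e | (G e).Adj u v}) (k : ℕ) (h : History V k) (S : Set V) :
    Measurable fun e => orrwKernel δ (G e) k h S := by
  classical
  have hw : ∀ u v, Measurable fun e => edgeWeight δ (G e) h u v := fun u v =>
    Measurable.ite (hG u v) measurable_const measurable_const
  have ht : Measurable fun e => ∑' v, edgeWeight δ (G e) h (h.pos k le_rfl) v :=
    Measurable.tsum fun v => hw _ v
  have hs : ∀ v, Measurable fun e => orrwStep δ (G e) k h v := by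
    intro v
    have : (fun e => orrwStep δ (G e) k h v) = fun e =>
        if (∑' v, edgeWeight δ (G e) h (h.pos k le_rfl) v) ≠ 0 ∧
          (∑' v, edgeWeight δ (G e) h (h.pos k le_rfl) v) ≠ ∞ then
        edgeWeight δ (G e) h (h.pos k le_rfl) v *
          (∑' v, edgeWeight δ (G e) h (h.pos k le_rfl) v)⁻¹
        else PMF.pure (h.pos k le_rfl) v := by
      funext e
      unfold orrwStep
      split_ifs <;> simp_all
    rw [this]
    refine Measurable.ite ?_ ((hw _ v).mul ht.inv) measurable_const
    exact ((ht (measurableSet_singleton 0)).compl).inter ((ht (measurableSet_singleton ∞)).compl)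
  have : (fun e => orrwKernel δ (G e) k h S) =
      fun e => ∑' v, S.indicator (fun v => orrwStep δ (G e) k h v) v := by
    funext e
    exact (orrwStep δ (G e) k h).toMeasure_apply .of_discrete
  rw [this]
  refine Measurable.tsum fun v => ?_
  by_cases hv : v ∈ S
  · simpa [hv] using hs v
  · simp [hv]

/-- For a graph that depends measurably on a parameter, so does the law of the walk. -/
theorem measurable_orrwLaw {E : Type*} [MeasurableSpace E] (δ : ℝ) (G : E → SimpleGraph V)
    (hG : ∀ u v, MeasurableSet {e | (G e).Adj u v}) (ρ : V) :
    Measurable fun e => orrwLaw δ (G e) ρ := by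
  have key : ∀ (n : ℕ) (S : Set (History V n)), Measurable fun e =>
      Kernel.partialTraj (X := fun _ => V) (orrwKernel δ (G e)) 0 n (fun _ => ρ) S := by
    intro n
    induction n with
    | zero =>
      intro S
      simp only [Kernel.partialTraj_self]
      exact measurable_const
    | succ n ih =>
      intro S
      have hS : MeasurableSet S := S.to_countable.measurableSet
      have : (fun e => Kernel.partialTraj (X := fun _ => V) (orrwKernel δ (G e)) 0 (n + 1)
          (fun _ => ρ) S) = fun e => ∑' h : History V n,
            orrwKernel δ (G e) n h
              {v | IicProdIoc (X := fun _ => V) n (n + 1)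
                (h, MeasurableEquiv.piSingleton (X := fun _ => V) n v) ∈ S} *
            Kernel.partialTraj (X := fun _ => V) (orrwKernel δ (G e)) 0 n (fun _ => ρ) {h} := by
        funext e
        rw [Kernel.partialTraj_succ_eq_comp (Nat.zero_le n), Kernel.comp_apply' _ _ _ hS,
          lintegral_countable']
        refine tsum_congr fun h => ?_
        congr 1
        rw [Kernel.partialTraj_succ_self, Kernel.map_apply' _ (by fun_prop) _ hS,
          Kernel.prod_apply, Kernel.id_apply, Kernel.map_apply _ (by fun_prop),
          Measure.dirac_prod, Measure.map_apply (by fun_prop) (by measurability),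
          Measure.map_apply (by fun_prop) (by measurability)]
        rfl
      rw [this]
      exact Measurable.tsum fun h => (measurable_orrwStep δ G hG n h _).mul (ih {h})
  refine Measurable.measure_of_isPiSystem_of_isProbabilityMeasure
    (generateFrom_measurableCylinders (α := fun _ : ℕ => V)).symm
    isPiSystem_measurableCylinders fun s hs => ?_
  obtain ⟨I, S, hS, rfl⟩ := (mem_measurableCylinders _).1 hs
  have hI : I ⊆ Finset.Iic (I.sup id) := fun i hi => Finset.mem_Iic.2 (Finset.le_sup (f := id) hi)
  have : (fun e => orrwLaw δ (G e) ρ (cylinder I S)) = fun e =>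
      Kernel.partialTraj (X := fun _ => V) (orrwKernel δ (G e)) 0 (I.sup id) (fun _ => ρ)
        (Finset.restrict₂ (π := fun _ => V) hI ⁻¹' S) := by
    funext e
    rw [← Kernel.traj_map_frestrictLe_apply]
    exact (Measure.map_apply (Preorder.measurable_frestrictLe _)
      (Finset.measurable_restrict₂ hI hS)).symm
  rw [this]
  exact key _ _

end OnceReinforced

/-- The process `X = (X_k)` with values in `V` on the probability space `(Ω, P)` is transient: with
positive probability it does not return to its starting point. -/
def IsTransient {Ω V : Type*} [MeasurableSpace Ω] (P : Measure Ω) (X : ℕ → Ω → V) : Prop :=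
  0 < P {ω | ∀ k, 1 ≤ k → X k ω ≠ X 0 ω}

/-! ### Galton–Watson trees -/

section GaltonWatson

/-- Addresses of individuals: `[]` is the root `ρ`, and `i :: v` is the `i`-th child of `v`
(children are numbered from `0`). The countable set of addresses is a discrete space. -/
instance : MeasurableSpace (List ℕ) := ⊤

instance : DiscreteMeasurableSpace (List ℕ) := ⟨fun _ => trivial⟩

/-- If the individual `v` has `N v` children, for every address `v`, these are the individuals that
are actually born. -/
def IsBorn (N : List ℕ → ℕ) : List ℕ → Prop
  | [] => True
  | i :: v => IsBorn N v ∧ i < N v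

/-- The family tree in which each individual `v` that is born has `N v` children: a parent and its
child are joined by an edge. Addresses that are not born are isolated points outside the tree. -/
def familyTree (N : List ℕ → ℕ) : SimpleGraph (List ℕ) where
  Adj u v := IsBorn N u ∧ IsBorn N v ∧ ((∃ i, v = i :: u) ∨ (∃ i, u = i :: v))
  symm := ⟨fun _ _ h => ⟨h.2.1, h.1, h.2.2.symm⟩⟩
  loopless := ⟨fun u h => by
    rcases h.2.2 with ⟨i, hi⟩ | ⟨i, hi⟩ <;> exact absurd (congrArg List.length hi) (by simp)⟩

/-- The law of the numbers of children in a branching process with offspring law `p`: they are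
independent and identically distributed with law `p`. -/
def offspringLaw (p : PMF ℕ) : Measure (List ℕ → ℕ) := Measure.infinitePi fun _ => p.toMeasure

instance (p : PMF ℕ) : IsProbabilityMeasure (offspringLaw p) :=
  inferInstanceAs (IsProbabilityMeasure (Measure.infinitePi fun _ : List ℕ => p.toMeasure))

/-- The mean of the offspring law. -/
def offspringMean (p : PMF ℕ) : ℝ≥0∞ := ∑' n : ℕ, p n * n

theorem measurableSet_isBorn (v : List ℕ) : MeasurableSet {N : List ℕ → ℕ | IsBorn N v} := by
  induction v with
  | nil => exact MeasurableSet.univ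
  | cons i v ih =>
    exact ih.inter (measurableSet_lt measurable_const (measurable_pi_apply v))

theorem measurableSet_familyTree_adj (u v : List ℕ) :
    MeasurableSet {N : List ℕ → ℕ | (familyTree N).Adj u v} :=
  (measurableSet_isBorn u).inter ((measurableSet_isBorn v).inter (MeasurableSet.const _))

/-- The conditional law of the once-reinforced random walk started from the root, given the
family tree. -/
def orrwOnTree (δ : ℝ) : Kernel (List ℕ → ℕ) (ℕ → List ℕ) where
  toFun N := orrwLaw δ (familyTree N) []
  measurable' := measurable_orrwLaw δ familyTree measurableSet_familyTree_adj []

instance (δ : ℝ) : IsMarkovKernel (orrwOnTree δ) :=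
  ⟨fun N => inferInstanceAs (IsProbabilityMeasure (orrwLaw δ (familyTree N) []))⟩

/-- The joint law of the Galton–Watson tree with offspring law `p` (given by its numbers of
children) and of the once-reinforced random walk with parameter `δ` on this tree, started from the
root. -/
def orrwOnGaltonWatson (p : PMF ℕ) (δ : ℝ) : Measure ((List ℕ → ℕ) × (ℕ → List ℕ)) :=
  (offspringLaw p).compProd (orrwOnTree δ)

instance (p : PMF ℕ) (δ : ℝ) : IsProbabilityMeasure (orrwOnGaltonWatson p δ) :=
  inferInstanceAs (IsProbabilityMeasure ((offspringLaw p).compProd (orrwOnTree δ)))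

end GaltonWatson

end

/-!
The proof follows the walk through its local times. Let every directed edge carry an exponential
clock that runs only while the walk is at its initial vertex, with rate `1` until the edge is first
traversed and with rate `d` after that. Stop the walk when it returns to the root. If a vertex is
left with the local time `t`, its edge to a child is crossed for the first time after an exponential
time with rate `1`, and then at the points of a Poisson process with rate `d`; each crossing is
followed by an exponential time, with rate `d`, that is spent at the child before the crossing back.
So the local times form a branching Markov chain on the tree, as long as all excursions return: the
local time of a child, for a parent with local time `t`, contributes to the mean of a function `F`
the amount `relax 1 0 (localTimeMean d F) t`, and the probability that no excursion into the subtree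
of the child escapes is `relax 1 1 (localTimeMean d F) t`, where `F` is the product of the
corresponding probabilities of the grandchildren.

**The annealed estimate.** Along a ray the chain can be solved: it maps the exponential law with
rate `d / n` to `n / (n + d)` times the exponential law with rate `d / (n + 1)`
(`gammaMean_relax_of_mem_expSpan`). Hence the local time survives `n` generations with a probability
of order `∏ j / (j + d)`, which decays only polynomially, so that the growth of a supercritical tree
wins: a truncated resolvent of the operator `K H = relax 1 0 (localTimeMean d H)` is a bounded
nonnegative function `H` with `H 1 > 0` and `H ≤ m * K H`, for any `m > 1` (`exists_subharmonic`). Comparison of the generating function with its tangent at `1`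
then keeps the probability of no escape below `1`, uniformly in the depth
(`exists_annealedReturn_le`). The branching property turns this into a statement about the random
tree (`lintegral_edgeReturn_le`): with positive probability the tree has `edgeReturn d N 1 < 1`.

**The walk on a fixed tree.** The clocks themselves are not constructed. Instead, the return
probability that they predict from the present position and the past of the walk is written down
explicitly (`returnValue`, `returnPotential`): the local times left on the path from the root to the
present position again form a chain, starting from an exponential law at the child of the root, and
every subtree that hangs off the path contributes a factor, which is the solution of
`f' = w (ω - f)` with `w` the current weight of its edge. Integration by parts against the Gamma
and Poisson densities shows that this function is harmonic for the jumps of the once-reinforced walk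
(`returnValue_jump`). It is therefore a nonnegative supermartingale, it equals `1` after a return,
and so it bounds the probability of a return (`orrwLaw_return_le`). If `edgeReturn d N 1 < 1`, its
value at some child of the root is less than `1` (`exists_returnValue_lt_one`), and the walk on this
tree escapes with positive probability.
-/

noncomputable section

/-! ### Gamma laws -/

section Densities
open Set Filter Topology
open scoped Nat

/-- The density of the Gamma law with shape `k + 1` and rate `d`. -/
def gammaDensity (d : ℝ) (k : ℕ) (s : ℝ) : ℝ := d ^ (k + 1) / k ! * (s ^ k * Real.exp (-(d * s)))

/-- The mean of `F` under the Gamma law with shape `k + 1` and rate `d`. -/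
def gammaMean (d : ℝ) (k : ℕ) (F : ℝ → ℝ) : ℝ := ∫ s in Ioi 0, gammaDensity d k s * F s

/-- `F` is measurable, and bounded on the half-line `[0, ∞)`. -/
structure IsBddMeas (F : ℝ → ℝ) : Prop where
  meas : Measurable F
  bdd : ∃ C, ∀ t, 0 ≤ t → |F t| ≤ C

theorem IsBddMeas.const (c : ℝ) : IsBddMeas fun _ => c :=
  ⟨measurable_const, |c|, fun _ _ => le_rfl⟩

theorem IsBddMeas.add {F G : ℝ → ℝ} (hF : IsBddMeas F) (hG : IsBddMeas G) :
    IsBddMeas fun t => F t + G t := by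
  obtain ⟨C, hC⟩ := hF.bdd
  obtain ⟨D, hD⟩ := hG.bdd
  exact ⟨hF.meas.add hG.meas, C + D, fun t ht =>
    (abs_add_le _ _).trans (add_le_add (hC t ht) (hD t ht))⟩

theorem IsBddMeas.mul {F G : ℝ → ℝ} (hF : IsBddMeas F) (hG : IsBddMeas G) :
    IsBddMeas fun t => F t * G t := by
  obtain ⟨C, hC⟩ := hF.bdd
  obtain ⟨D, hD⟩ := hG.bdd
  refine ⟨hF.meas.mul hG.meas, C * D, fun t ht => ?_⟩
  rw [abs_mul]
  exact mul_le_mul (hC t ht) (hD t ht) (abs_nonneg _) ((abs_nonneg _).trans (hC t ht))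

theorem IsBddMeas.const_mul {F : ℝ → ℝ} (c : ℝ) (hF : IsBddMeas F) :
    IsBddMeas fun t => c * F t := (IsBddMeas.const c).mul hF

theorem IsBddMeas.sub {F G : ℝ → ℝ} (hF : IsBddMeas F) (hG : IsBddMeas G) :
    IsBddMeas fun t => F t - G t := by
  simpa [sub_eq_add_neg] using hF.add (hG.const_mul (-1))

theorem IsBddMeas.sum {ι : Type*} (s : Finset ι) {F : ι → ℝ → ℝ} (hF : ∀ i ∈ s, IsBddMeas (F i)) :
    IsBddMeas fun t => ∑ i ∈ s, F i t := by
  classical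
  induction s using Finset.induction_on with
  | empty => simpa using IsBddMeas.const 0
  | insert a s ha ih =>
    simp only [Finset.sum_insert ha]
    exact (hF a (Finset.mem_insert_self a s)).add
      (ih fun i hi => hF i (Finset.mem_insert_of_mem hi))

theorem gammaDensity_nonneg {d : ℝ} (hd : 0 < d) (k : ℕ) {s : ℝ} (hs : 0 ≤ s) :
    0 ≤ gammaDensity d k s := by
  unfold gammaDensity; positivity

theorem continuous_gammaDensity (d : ℝ) (k : ℕ) : Continuous (gammaDensity d k) := by
  unfold gammaDensity; fun_prop

theorem integral_pow_mul_exp_neg_mul_Ioi (k : ℕ) {r : ℝ} (hr : 0 < r) :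
    ∫ s in Ioi 0, s ^ k * Real.exp (-(r * s)) = k ! / r ^ (k + 1) := by
  have h := Real.integral_rpow_mul_exp_neg_mul_Ioi (a := k + 1) (r := r) (by positivity) hr
  rw [Real.Gamma_nat_eq_factorial] at h
  simp only [add_sub_cancel_right, Real.rpow_natCast] at h
  rw [h, show ((k : ℝ) + 1) = ((k + 1 : ℕ) : ℝ) by push_cast; rfl, Real.rpow_natCast, one_div,
    inv_pow, div_eq_inv_mul]

theorem integrableOn_pow_mul_exp_neg_mul_Ioi (k : ℕ) {r : ℝ} (hr : 0 < r) :
    IntegrableOn (fun s => s ^ k * Real.exp (-(r * s))) (Ioi 0) := by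
  by_contra h
  have h0 := integral_undef h
  rw [integral_pow_mul_exp_neg_mul_Ioi k hr] at h0
  have : (0 : ℝ) < k ! / r ^ (k + 1) := by positivity
  linarith

theorem integrableOn_gammaDensity {d : ℝ} (hd : 0 < d) (k : ℕ) :
    IntegrableOn (gammaDensity d k) (Ioi 0) :=
  (integrableOn_pow_mul_exp_neg_mul_Ioi k hd).const_mul _

theorem integral_gammaDensity {d : ℝ} (hd : 0 < d) (k : ℕ) :
    ∫ s in Ioi 0, gammaDensity d k s = 1 := by
  unfold gammaDensity
  rw [integral_const_mul, integral_pow_mul_exp_neg_mul_Ioi k hd]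
  field_simp

theorem IsBddMeas.integrableOn_gamma {d : ℝ} (hd : 0 < d) (k : ℕ) {F : ℝ → ℝ}
    (hF : IsBddMeas F) : IntegrableOn (fun s => gammaDensity d k s * F s) (Ioi 0) := by
  obtain ⟨C, hC⟩ := hF.bdd
  refine (integrableOn_gammaDensity hd k).mul_bdd (c := C) hF.meas.aestronglyMeasurable ?_
  exact (ae_restrict_mem measurableSet_Ioi).mono fun s hs => hC s (le_of_lt hs)

theorem gammaMean_const {d : ℝ} (hd : 0 < d) (k : ℕ) (c : ℝ) : gammaMean d k (fun _ => c) = c := by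
  unfold gammaMean
  rw [integral_mul_const, integral_gammaDensity hd, one_mul]

theorem gammaMean_mono {d : ℝ} (hd : 0 < d) (k : ℕ) {F G : ℝ → ℝ} (hF : IsBddMeas F)
    (hG : IsBddMeas G) (h : ∀ t, 0 ≤ t → F t ≤ G t) : gammaMean d k F ≤ gammaMean d k G := by
  refine setIntegral_mono_on (hF.integrableOn_gamma hd k) (hG.integrableOn_gamma hd k)
    measurableSet_Ioi fun s hs => ?_
  exact mul_le_mul_of_nonneg_left (h s (le_of_lt hs)) (gammaDensity_nonneg hd k (le_of_lt hs))

theorem gammaMean_congr (d : ℝ) (k : ℕ) {F G : ℝ → ℝ} (h : ∀ t, 0 ≤ t → F t = G t) :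
    gammaMean d k F = gammaMean d k G :=
  setIntegral_congr_fun measurableSet_Ioi fun s hs => by
    simp only [h s (le_of_lt hs)]

theorem gammaMean_const_mul (d : ℝ) (k : ℕ) (c : ℝ) (F : ℝ → ℝ) :
    gammaMean d k (fun t => c * F t) = c * gammaMean d k F := by
  unfold gammaMean
  rw [← integral_const_mul]
  congr 1 with s
  ring

theorem gammaMean_add {d : ℝ} (hd : 0 < d) (k : ℕ) {F G : ℝ → ℝ} (hF : IsBddMeas F)
    (hG : IsBddMeas G) :
    gammaMean d k (fun t => F t + G t) = gammaMean d k F + gammaMean d k G := by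
  unfold gammaMean
  rw [← integral_add (hF.integrableOn_gamma hd k) (hG.integrableOn_gamma hd k)]
  congr 1 with s
  ring

theorem gammaMean_sub {d : ℝ} (hd : 0 < d) (k : ℕ) {F G : ℝ → ℝ} (hF : IsBddMeas F)
    (hG : IsBddMeas G) :
    gammaMean d k (fun t => F t - G t) = gammaMean d k F - gammaMean d k G := by
  unfold gammaMean
  rw [← integral_sub (hF.integrableOn_gamma hd k) (hG.integrableOn_gamma hd k)]
  congr 1 with s
  ring

theorem gammaMean_sum {d : ℝ} (hd : 0 < d) (k : ℕ) {ι : Type*} (s : Finset ι) {F : ι → ℝ → ℝ}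
    (hF : ∀ i ∈ s, IsBddMeas (F i)) :
    gammaMean d k (fun t => ∑ i ∈ s, F i t) = ∑ i ∈ s, gammaMean d k (F i) := by
  classical
  induction s using Finset.induction_on with
  | empty => simp [gammaMean_const hd k 0]
  | insert a s ha ih =>
    simp only [Finset.sum_insert ha]
    have h := fun i hi => hF i (Finset.mem_insert_of_mem hi)
    rw [gammaMean_add hd k (hF a (Finset.mem_insert_self a s)) (IsBddMeas.sum s h), ih h]

theorem abs_gammaMean_le {d : ℝ} (hd : 0 < d) (k : ℕ) {F : ℝ → ℝ} (hF : IsBddMeas F) {C : ℝ}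
    (hC : ∀ t, 0 ≤ t → |F t| ≤ C) : |gammaMean d k F| ≤ C := by
  rw [abs_le]
  constructor
  · rw [← gammaMean_const hd k (-C)]
    exact gammaMean_mono hd k (IsBddMeas.const _) hF fun t ht => (abs_le.1 (hC t ht)).1
  · rw [← gammaMean_const hd k C]
    exact gammaMean_mono hd k hF (IsBddMeas.const _) fun t ht => (abs_le.1 (hC t ht)).2

theorem hasDerivAt_gammaDensity_zero (d t : ℝ) :
    HasDerivAt (gammaDensity d 0) (-d * gammaDensity d 0 t) t := by
  have h1 : HasDerivAt (fun s : ℝ => Real.exp (-(d * s))) (Real.exp (-(d * t)) * (-(d * 1))) t :=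
    (((hasDerivAt_id t).const_mul d).neg).exp
  have h2 := h1.const_mul d
  have e : gammaDensity d 0 = fun s => d * Real.exp (-(d * s)) := by
    funext s; simp [gammaDensity]
  rw [e]
  convert! h2 using 1
  ring

theorem hasDerivAt_gammaDensity_succ (d : ℝ) (k : ℕ) (t : ℝ) :
    HasDerivAt (gammaDensity d (k + 1))
      (d * (gammaDensity d k t - gammaDensity d (k + 1) t)) t := by
  have h1 : HasDerivAt (fun s : ℝ => Real.exp (-(d * s))) (Real.exp (-(d * t)) * (-(d * 1))) t :=
    (((hasDerivAt_id t).const_mul d).neg).exp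
  have h2 := (((hasDerivAt_pow (k + 1) t).mul h1)).const_mul (d ^ (k + 1 + 1) / (k + 1)!)
  convert! h2 using 1
  unfold gammaDensity
  rw [Nat.factorial_succ]
  push_cast
  field_simp
  ring_nf

theorem tendsto_gammaDensity (k : ℕ) {d : ℝ} (hd : 0 < d) :
    Tendsto (gammaDensity d k) atTop (𝓝 0) := by
  have h := (Real.tendsto_pow_mul_exp_neg_atTop_nhds_zero k).comp
    (tendsto_id.const_mul_atTop hd)
  have h2 := h.const_mul (d / k !)
  rw [mul_zero] at h2
  refine h2.congr fun s => ?_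
  simp only [Function.comp, id, gammaDensity, mul_pow]
  ring

theorem tendsto_gammaDensity_mul (k : ℕ) {d : ℝ} (hd : 0 < d) {F : ℝ → ℝ} (hF : IsBddMeas F) :
    Tendsto (fun s => gammaDensity d k s * F s) atTop (𝓝 0) := by
  obtain ⟨C, hC⟩ := hF.bdd
  refine (tendsto_gammaDensity k hd).zero_mul_isBoundedUnder_le ⟨C, ?_⟩
  rw [eventually_map]
  filter_upwards [eventually_ge_atTop 0] with s hs using hC s hs

theorem gammaMean_zero_deriv {d : ℝ} (hd : 0 < d) {F F' : ℝ → ℝ} (hF : IsBddMeas F)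
    (hF' : IsBddMeas F') (h : ∀ t, 0 ≤ t → HasDerivAt F (F' t) t) :
    gammaMean d 0 F' = d * (gammaMean d 0 F - F 0) := by
  have key := integral_Ioi_of_hasDerivAt_of_tendsto' (a := 0)
    (f := fun s => gammaDensity d 0 s * F s)
    (f' := fun s => gammaDensity d 0 s * F' s - d * (gammaDensity d 0 s * F s)) (m := 0)
    (fun s hs => by
      convert! (hasDerivAt_gammaDensity_zero d s).mul (h s hs) using 1
      ring)
    ((hF'.integrableOn_gamma hd 0).sub ((hF.integrableOn_gamma hd 0).const_mul d))
    (tendsto_gammaDensity_mul 0 hd hF)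
  rw [integral_sub (hF'.integrableOn_gamma hd 0) ((hF.integrableOn_gamma hd 0).const_mul d),
    integral_const_mul] at key
  have e : gammaDensity d 0 0 = d := by simp [gammaDensity]
  rw [e] at key
  unfold gammaMean
  linarith

theorem gammaMean_succ_deriv {d : ℝ} (hd : 0 < d) (k : ℕ) {F F' : ℝ → ℝ} (hF : IsBddMeas F)
    (hF' : IsBddMeas F') (h : ∀ t, 0 ≤ t → HasDerivAt F (F' t) t) :
    gammaMean d (k + 1) F' = d * (gammaMean d (k + 1) F - gammaMean d k F) := by
  have key := integral_Ioi_of_hasDerivAt_of_tendsto' (a := 0)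
    (f := fun s => gammaDensity d (k + 1) s * F s)
    (f' := fun s => gammaDensity d (k + 1) s * F' s + d * (gammaDensity d k s * F s
      - gammaDensity d (k + 1) s * F s)) (m := 0)
    (fun s hs => by
      convert! (hasDerivAt_gammaDensity_succ d k s).mul (h s hs) using 1
      ring)
    ((hF'.integrableOn_gamma hd _).add
      (((hF.integrableOn_gamma hd _).sub (hF.integrableOn_gamma hd _)).const_mul d))
    (tendsto_gammaDensity_mul _ hd hF)
  have hsub := (hF.integrableOn_gamma hd k).sub (hF.integrableOn_gamma hd (k + 1))
  have hadd := integral_add (hF'.integrableOn_gamma hd (k + 1)) (hsub.const_mul d)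
  simp only [Pi.sub_apply] at hadd
  rw [hadd, integral_const_mul,
    integral_sub (hF.integrableOn_gamma hd _) (hF.integrableOn_gamma hd _)] at key
  have e : gammaDensity d (k + 1) 0 = 0 := by simp [gammaDensity]
  rw [e] at key
  unfold gammaMean
  linarith

end Densities

/-! ### Poisson means -/

section Poisson
open Set Filter Topology
open scoped Nat

/-- The probability that a Poisson variable with parameter `d * t` takes the value `k`. -/
def poissonWeight (d : ℝ) (t : ℝ) (k : ℕ) : ℝ := Real.exp (-(d * t)) * ((d * t) ^ k / k !)

/-- The mean of `a` under the Poisson law with parameter `d * t`. -/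
def poissonMean (d : ℝ) (a : ℕ → ℝ) (t : ℝ) : ℝ := ∑' k, poissonWeight d t k * a k

theorem poissonWeight_nonneg {d t : ℝ} (hd : 0 < d) (ht : 0 ≤ t) (k : ℕ) :
    0 ≤ poissonWeight d t k := by
  unfold poissonWeight; positivity

theorem continuous_poissonWeight (d : ℝ) (k : ℕ) : Continuous fun t => poissonWeight d t k := by
  unfold poissonWeight; fun_prop

theorem summable_pow_div_factorial_mul {a : ℕ → ℝ} {C : ℝ} (ha : ∀ k, |a k| ≤ C) (x : ℝ) :
    Summable fun k => x ^ k / k ! * a k := by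
  refine .of_norm_bounded ((Real.summable_pow_div_factorial |x|).mul_right C) fun k => ?_
  rw [norm_mul, Real.norm_eq_abs, Real.norm_eq_abs, abs_div, abs_pow, Nat.abs_cast]
  exact mul_le_mul_of_nonneg_left (ha k) (by positivity)

theorem summable_poissonWeight_mul (d t : ℝ) {a : ℕ → ℝ} {C : ℝ} (ha : ∀ k, |a k| ≤ C) :
    Summable fun k => poissonWeight d t k * a k := by
  simpa [poissonWeight, mul_assoc] using
    (summable_pow_div_factorial_mul ha (d * t)).mul_left (Real.exp (-(d * t)))

theorem hasDerivAt_tsum_pow_div_factorial_mul {a : ℕ → ℝ} {C : ℝ} (ha : ∀ k, |a k| ≤ C) (x : ℝ) :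
    HasDerivAt (fun x => ∑' k, x ^ k / k ! * a k) (∑' k, x ^ k / k ! * a (k + 1)) x := by
  set R := |x| + 1
  have hC : 0 ≤ C := (abs_nonneg _).trans (ha 0)
  have hs : Summable fun k : ℕ => (k : ℝ) * R ^ (k - 1) / k ! * C := by
    rw [← summable_nat_add_iff 1]
    refine ((Real.summable_pow_div_factorial R).mul_right C).congr fun k => ?_
    rw [Nat.factorial_succ]
    push_cast
    field_simp
  have key := hasDerivAt_tsum_of_isPreconnected (𝕜 := ℝ) (t := Metric.ball 0 R)
    (g := fun k x => x ^ k / k ! * a k)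
    (g' := fun k x => (k : ℝ) * x ^ (k - 1) / k ! * a k) (y₀ := x) (y := x) hs Metric.isOpen_ball
    (convex_ball 0 R).isPreconnected
    (fun k y _ => ((hasDerivAt_pow k y).div_const _).mul_const _)
    (fun k y hy => by
      have hy' : |y| ≤ R := by simpa using (Metric.mem_ball.1 hy).le
      rw [norm_mul, Real.norm_eq_abs, Real.norm_eq_abs, abs_div, abs_mul, abs_pow, Nat.abs_cast,
        Nat.abs_cast]
      exact mul_le_mul (by gcongr) (ha k) (abs_nonneg _) (by positivity))
    (by simp [R]) (summable_pow_div_factorial_mul ha x) (by simp [R])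
  convert! key using 1
  have hs' : Summable fun k : ℕ => (k : ℝ) * x ^ (k - 1) / k ! * a k := by
    rw [← summable_nat_add_iff 1]
    refine (summable_pow_div_factorial_mul (fun k => ha (k + 1)) x).congr fun k => ?_
    rw [Nat.factorial_succ]
    push_cast
    field_simp
  rw [hs'.tsum_eq_zero_add]
  simp only [Nat.cast_zero, zero_mul, zero_div, zero_add]
  refine tsum_congr fun k => ?_
  rw [Nat.factorial_succ]
  push_cast
  field_simp

theorem poissonMean_eq (d : ℝ) (a : ℕ → ℝ) (t : ℝ) :
    poissonMean d a t = Real.exp (-(d * t)) * ∑' k, (d * t) ^ k / k ! * a k := by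
  rw [← tsum_mul_left]
  exact tsum_congr fun k => by rw [poissonWeight, mul_assoc]

/-- The Kolmogorov equation of the Poisson process. -/
theorem hasDerivAt_poissonMean (d : ℝ) {a : ℕ → ℝ} {C : ℝ} (ha : ∀ k, |a k| ≤ C) (t : ℝ) :
    HasDerivAt (poissonMean d a)
      (d * (poissonMean d (fun k => a (k + 1)) t - poissonMean d a t)) t := by
  have e : poissonMean d a = fun t => Real.exp (-(d * t)) * ∑' k, (d * t) ^ k / k ! * a k :=
    funext (poissonMean_eq d a)
  have hid : HasDerivAt (fun s : ℝ => d * s) (d * 1) t := (hasDerivAt_id t).const_mul d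
  have h1 := hid.neg.exp
  have h2 := (hasDerivAt_tsum_pow_div_factorial_mul ha (d * t)).comp t hid
  have h3 := h1.mul h2
  rw [poissonMean_eq, poissonMean_eq, e]
  convert! h3 using 1
  simp only [Function.comp, Pi.neg_apply]
  ring

theorem continuous_poissonMean (d : ℝ) {a : ℕ → ℝ} {C : ℝ} (ha : ∀ k, |a k| ≤ C) :
    Continuous (poissonMean d a) :=
  continuous_iff_continuousAt.2 fun t => (hasDerivAt_poissonMean d ha t).continuousAt

theorem poissonMean_const (d c t : ℝ) : poissonMean d (fun _ => c) t = c := by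
  rw [poissonMean_eq, tsum_mul_right]
  have := congrFun (Real.exp_eq_exp_ℝ) (d * t)
  rw [NormedSpace.exp_eq_tsum_div] at this
  change _ = ∑' k : ℕ, (d * t) ^ k / (k ! : ℝ) at this
  rw [← this, ← mul_assoc, ← Real.exp_add]
  simp

theorem poissonMean_mono {d t : ℝ} (hd : 0 < d) (ht : 0 ≤ t) {a b : ℕ → ℝ} {C D : ℝ}
    (ha : ∀ k, |a k| ≤ C) (hb : ∀ k, |b k| ≤ D) (h : ∀ k, a k ≤ b k) :
    poissonMean d a t ≤ poissonMean d b t :=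
  (summable_poissonWeight_mul d t ha).tsum_le_tsum
    (fun k => mul_le_mul_of_nonneg_left (h k) (poissonWeight_nonneg hd ht k))
    (summable_poissonWeight_mul d t hb)

theorem poissonMean_const_mul (d c : ℝ) (a : ℕ → ℝ) (t : ℝ) :
    poissonMean d (fun k => c * a k) t = c * poissonMean d a t := by
  unfold poissonMean
  rw [← tsum_mul_left]
  exact tsum_congr fun k => by ring

theorem poissonMean_add (d t : ℝ) {a b : ℕ → ℝ} {C D : ℝ}
    (ha : ∀ k, |a k| ≤ C) (hb : ∀ k, |b k| ≤ D) :
    poissonMean d (fun k => a k + b k) t = poissonMean d a t + poissonMean d b t := by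
  unfold poissonMean
  rw [← (summable_poissonWeight_mul d t ha).tsum_add (summable_poissonWeight_mul d t hb)]
  exact tsum_congr fun k => by ring

theorem poissonMean_zero (d : ℝ) (a : ℕ → ℝ) : poissonMean d a 0 = a 0 := by
  unfold poissonMean
  rw [tsum_eq_single 0]
  · simp [poissonWeight]
  · intro k hk
    simp [poissonWeight, hk]

end Poisson

/-! ### The transition of local times along an edge -/

section LocalTime
open Set Filter Topology
open scoped Nat

/-- The solution of `f' = w (ω - f)`, `f 0 = c`. -/
def relax (w c : ℝ) (ω : ℝ → ℝ) (t : ℝ) : ℝ :=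
  Real.exp (-(w * t)) * (c + ∫ s in (0 : ℝ)..t, w * Real.exp (w * s) * ω s)

theorem relax_zero (w c : ℝ) (ω : ℝ → ℝ) : relax w c ω 0 = c := by simp [relax]

theorem hasDerivAt_relax (w c : ℝ) {ω : ℝ → ℝ} (hω : Continuous ω) (t : ℝ) :
    HasDerivAt (relax w c ω) (w * (ω t - relax w c ω t)) t := by
  have hc : Continuous fun s => w * Real.exp (w * s) * ω s := by fun_prop
  have hid : HasDerivAt (fun s : ℝ => w * s) (w * 1) t := (hasDerivAt_id t).const_mul w
  have h1 := hid.fun_neg.exp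
  have h2 := (hc.integral_hasStrictDerivAt 0 t).hasDerivAt.const_add c
  have h3 := h1.mul h2
  convert! h3 using 1
  have e : Real.exp (-(w * t)) * Real.exp (w * t) = 1 := by rw [← Real.exp_add]; simp
  unfold relax
  linear_combination (-w * ω t) * e

theorem continuous_relax (w c : ℝ) {ω : ℝ → ℝ} (hω : Continuous ω) : Continuous (relax w c ω) :=
  continuous_iff_continuousAt.2 fun t => (hasDerivAt_relax w c hω t).continuousAt

/-- Uniqueness for the differential equation of `relax`. -/
theorem eq_relax {w c : ℝ} {ω f : ℝ → ℝ} (hω : Continuous ω) (h0 : f 0 = c)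
    (hf : ∀ t, HasDerivAt f (w * (ω t - f t)) t) : f = relax w c ω := by
  have key : ∀ t, HasDerivAt (fun t => Real.exp (w * t) * (f t - relax w c ω t)) 0 t := by
    intro t
    have hid : HasDerivAt (fun s : ℝ => w * s) (w * 1) t := (hasDerivAt_id t).const_mul w
    convert! hid.exp.mul ((hf t).sub (hasDerivAt_relax w c hω t)) using 1
    simp only [Pi.sub_apply]
    ring
  have hconst := is_const_of_deriv_eq_zero (fun t => (key t).differentiableAt)
    (fun t => (key t).deriv)
  funext t
  have := hconst t 0
  simp only [h0, relax_zero, sub_self, mul_zero, mul_eq_zero, Real.exp_ne_zero, false_or] at this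
  linarith

theorem relax_mono {w c c' : ℝ} (hw : 0 ≤ w) {ω ω' : ℝ → ℝ} (hω : Continuous ω)
    (hω' : Continuous ω') {t : ℝ} (ht : 0 ≤ t) (hc : c ≤ c')
    (h : ∀ s, 0 ≤ s → s ≤ t → ω s ≤ ω' s) : relax w c ω t ≤ relax w c' ω' t := by
  unfold relax
  gcongr
  refine intervalIntegral.integral_mono_on ht (Continuous.intervalIntegrable (by fun_prop) _ _)
    (Continuous.intervalIntegrable (by fun_prop) _ _) fun s hs => ?_
  exact mul_le_mul_of_nonneg_left (h s hs.1 hs.2) (by positivity)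

theorem relax_const (w c t : ℝ) : relax w c (fun _ => c) t = c := by
  have := eq_relax (w := w) (c := c) (ω := fun _ => c) (f := fun _ => c) continuous_const rfl
    (fun t => by simpa using hasDerivAt_const t c)
  exact (congrFun this t).symm

theorem relax_add (w c c' : ℝ) {ω ω' : ℝ → ℝ} (hω : Continuous ω) (hω' : Continuous ω') (t : ℝ) :
    relax w (c + c') (fun s => ω s + ω' s) t = relax w c ω t + relax w c' ω' t := by
  unfold relax
  simp only [mul_add]
  rw [intervalIntegral.integral_add (Continuous.intervalIntegrable (by fun_prop) _ _)
    (Continuous.intervalIntegrable (by fun_prop) _ _)]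
  ring

theorem relax_const_mul (w c a : ℝ) (ω : ℝ → ℝ) (t : ℝ) :
    relax w (a * c) (fun s => a * ω s) t = a * relax w c ω t := by
  unfold relax
  have : ∀ s, w * Real.exp (w * s) * (a * ω s) = a * (w * Real.exp (w * s) * ω s) := fun s => by
    ring
  simp only [this, intervalIntegral.integral_const_mul]
  ring

/-- The mean of `F (S_{N + 1})`, where `N` is a Poisson variable with parameter `d * t` and `S_k`
is a sum of `k` independent exponential variables with rate `d`. -/
def localTimeMean (d : ℝ) (F : ℝ → ℝ) (t : ℝ) : ℝ := poissonMean d (fun k => gammaMean d k F) t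

variable {d : ℝ}

theorem IsBddMeas.exists_gammaMean_le (hd : 0 < d) {F : ℝ → ℝ} (hF : IsBddMeas F) :
    ∃ C, ∀ k, |gammaMean d k F| ≤ C := by
  obtain ⟨C, hC⟩ := hF.bdd
  exact ⟨C, fun k => abs_gammaMean_le hd k hF hC⟩

theorem IsBddMeas.continuous_localTimeMean (hd : 0 < d) {F : ℝ → ℝ} (hF : IsBddMeas F) :
    Continuous (localTimeMean d F) := by
  obtain ⟨C, hC⟩ := hF.exists_gammaMean_le hd
  exact continuous_poissonMean d hC

theorem localTimeMean_mono (hd : 0 < d) {F G : ℝ → ℝ} (hF : IsBddMeas F) (hG : IsBddMeas G)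
    (h : ∀ t, 0 ≤ t → F t ≤ G t) {t : ℝ} (ht : 0 ≤ t) :
    localTimeMean d F t ≤ localTimeMean d G t := by
  obtain ⟨C, hC⟩ := hF.exists_gammaMean_le hd
  obtain ⟨D, hD⟩ := hG.exists_gammaMean_le hd
  exact poissonMean_mono hd ht hC hD fun k => gammaMean_mono hd k hF hG h

theorem localTimeMean_const (hd : 0 < d) (c t : ℝ) : localTimeMean d (fun _ => c) t = c := by
  simp only [localTimeMean, gammaMean_const hd, poissonMean_const]

theorem localTimeMean_congr (d : ℝ) {F G : ℝ → ℝ} (h : ∀ t, 0 ≤ t → F t = G t) (t : ℝ) :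
    localTimeMean d F t = localTimeMean d G t := by
  simp only [localTimeMean, gammaMean_congr d _ h]

theorem localTimeMean_const_mul (d c : ℝ) (F : ℝ → ℝ) (t : ℝ) :
    localTimeMean d (fun s => c * F s) t = c * localTimeMean d F t := by
  simp only [localTimeMean, gammaMean_const_mul, poissonMean_const_mul]

theorem localTimeMean_add (hd : 0 < d) {F G : ℝ → ℝ} (hF : IsBddMeas F) (hG : IsBddMeas G)
    (t : ℝ) :
    localTimeMean d (fun s => F s + G s) t = localTimeMean d F t + localTimeMean d G t := by
  obtain ⟨C, hC⟩ := hF.exists_gammaMean_le hd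
  obtain ⟨D, hD⟩ := hG.exists_gammaMean_le hd
  simp only [localTimeMean, gammaMean_add hd _ hF hG]
  exact poissonMean_add d t hC hD

theorem localTimeMean_sum (hd : 0 < d) {ι : Type*} (s : Finset ι) {F : ι → ℝ → ℝ}
    (hF : ∀ i ∈ s, IsBddMeas (F i)) (t : ℝ) :
    localTimeMean d (fun t => ∑ i ∈ s, F i t) t = ∑ i ∈ s, localTimeMean d (F i) t := by
  classical
  induction s using Finset.induction_on with
  | empty => simp [localTimeMean_const hd 0]
  | insert a s ha ih =>
    simp only [Finset.sum_insert ha]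
    have h := fun i hi => hF i (Finset.mem_insert_of_mem hi)
    rw [localTimeMean_add hd (hF a (Finset.mem_insert_self a s)) (IsBddMeas.sum s h), ih h]

theorem IsBddMeas.localTimeMean (hd : 0 < d) {F : ℝ → ℝ} (hF : IsBddMeas F) :
    IsBddMeas (localTimeMean d F) := by
  refine ⟨(hF.continuous_localTimeMean hd).measurable, ?_⟩
  obtain ⟨C, hC⟩ := hF.bdd
  refine ⟨C, fun t ht => abs_le.2 ⟨?_, ?_⟩⟩
  · rw [← localTimeMean_const hd (-C) t]
    exact localTimeMean_mono hd (IsBddMeas.const _) hF (fun s hs => (abs_le.1 (hC s hs)).1) ht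
  · rw [← localTimeMean_const hd C t]
    exact localTimeMean_mono hd hF (IsBddMeas.const _) (fun s hs => (abs_le.1 (hC s hs)).2) ht

/-- Integration by parts in the local time. -/
theorem localTimeMean_deriv (hd : 0 < d) {F F' : ℝ → ℝ} (hF : IsBddMeas F) (hF' : IsBddMeas F')
    (h : ∀ t, 0 ≤ t → HasDerivAt F (F' t) t) (t : ℝ) :
    localTimeMean d F' t
      = d * (localTimeMean d F t - relax d (F 0) (localTimeMean d F) t) := by
  let a : ℕ → ℝ := fun k => k.casesOn (F 0) fun k => gammaMean d k F
  obtain ⟨C, hC⟩ := hF.bdd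
  have ha : ∀ k, |a k| ≤ C := by
    rintro (_ | k)
    · exact hC 0 le_rfl
    · exact abs_gammaMean_le hd k hF hC
  have hstep : ∀ k, gammaMean d k F' = d * (a (k + 1) + -1 * a k) := by
    rintro (_ | k)
    · rw [gammaMean_zero_deriv hd hF hF' h]
      change d * (gammaMean d 0 F - F 0) = d * (gammaMean d 0 F + -1 * F 0)
      ring
    · rw [gammaMean_succ_deriv hd k hF hF' h]
      simp only [a]; ring
  have hrel : poissonMean d a = relax d (F 0) (localTimeMean d F) :=
    eq_relax (hF.continuous_localTimeMean hd) (poissonMean_zero d a)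
      (fun t => hasDerivAt_poissonMean d ha t)
  rw [← hrel]
  unfold localTimeMean
  simp only [hstep]
  have ha' : ∀ k, |-1 * a k| ≤ C := fun k => by simpa using ha k
  rw [poissonMean_const_mul, poissonMean_add d t (fun k => ha (k + 1)) ha', poissonMean_const_mul]
  simp only [a]
  ring

/-- The harmonic identity of the jumps away from a vertex with one edge of weight `d` towards the
parent and edges of weights `w i` towards the children, integrated against the local time left at
the vertex: `A` describes the state in which the walk is at the vertex, and `C i` the state after a
jump to the child `i`. -/
theorem localTimeMean_jump (hd : 0 < d) {ι : Type*} (s : Finset ι) (w : ι → ℝ) {A : ℝ → ℝ}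
    {C : ι → ℝ → ℝ} (hA : IsBddMeas A) (hC : ∀ i ∈ s, IsBddMeas (C i))
    (h : ∀ t, 0 ≤ t → HasDerivAt A (∑ i ∈ s, w i * C i t - (∑ i ∈ s, w i) * A t) t) (t : ℝ) :
    (d + ∑ i ∈ s, w i) * localTimeMean d A t
      = d * relax d (A 0) (localTimeMean d A) t + ∑ i ∈ s, w i * localTimeMean d (C i) t := by
  have h1 : IsBddMeas fun t => ∑ i ∈ s, w i * C i t :=
    IsBddMeas.sum s fun i hi => (hC i hi).const_mul (w i)
  have h2 : IsBddMeas fun t => (-∑ i ∈ s, w i) * A t := hA.const_mul _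
  have h' : ∀ t, 0 ≤ t → HasDerivAt A (∑ i ∈ s, w i * C i t + (-∑ i ∈ s, w i) * A t) t :=
    fun t ht => by simpa [sub_eq_add_neg] using h t ht
  have key := localTimeMean_deriv hd hA (h1.add h2) h' t
  rw [localTimeMean_add hd h1 h2, localTimeMean_const_mul,
    localTimeMean_sum hd s fun i hi => (hC i hi).const_mul (w i)] at key
  simp only [localTimeMean_const_mul] at key
  linarith

theorem gammaMean_jump (hd : 0 < d) {ι : Type*} (s : Finset ι) (w : ι → ℝ) {A : ℝ → ℝ}
    {C : ι → ℝ → ℝ} (hA : IsBddMeas A) (hC : ∀ i ∈ s, IsBddMeas (C i))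
    (h : ∀ t, 0 ≤ t → HasDerivAt A (∑ i ∈ s, w i * C i t - (∑ i ∈ s, w i) * A t) t) :
    (d + ∑ i ∈ s, w i) * gammaMean d 0 A
      = d * A 0 + ∑ i ∈ s, w i * gammaMean d 0 (C i) := by
  have h1 : IsBddMeas fun t => ∑ i ∈ s, w i * C i t :=
    IsBddMeas.sum s fun i hi => (hC i hi).const_mul (w i)
  have h2 : IsBddMeas fun t => (-∑ i ∈ s, w i) * A t := hA.const_mul _
  have h' : ∀ t, 0 ≤ t → HasDerivAt A (∑ i ∈ s, w i * C i t + (-∑ i ∈ s, w i) * A t) t :=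
    fun t ht => by simpa [sub_eq_add_neg] using h t ht
  have key := gammaMean_zero_deriv hd hA (h1.add h2) h'
  rw [gammaMean_add hd 0 h1 h2, gammaMean_const_mul,
    gammaMean_sum hd 0 s fun i hi => (hC i hi).const_mul (w i)] at key
  simp only [gammaMean_const_mul] at key
  linarith

end LocalTime

/-! ### Exponential functions of the local time -/

section Exponentials
open Set Filter Topology
open scoped Nat

variable {d : ℝ}

theorem isBddMeas_exp {r : ℝ} (hr : 0 ≤ r) : IsBddMeas fun t => Real.exp (-(r * t)) := by
  refine ⟨by fun_prop, 1, fun t ht => ?_⟩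
  rw [abs_of_pos (Real.exp_pos _), Real.exp_le_one_iff]
  have : 0 ≤ r * t := by positivity
  linarith

theorem gammaMean_exp (hd : 0 < d) {r : ℝ} (hr : 0 ≤ r) (k : ℕ) :
    gammaMean d k (fun t => Real.exp (-(r * t))) = (d / (d + r)) ^ (k + 1) := by
  have e : ∀ s, gammaDensity d k s * Real.exp (-(r * s))
      = d ^ (k + 1) / k ! * (s ^ k * Real.exp (-((d + r) * s))) := fun s => by
    rw [gammaDensity, show -((d + r) * s) = -(d * s) + -(r * s) by ring, Real.exp_add]
    ring
  have hdr : 0 < d + r := by positivity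
  simp only [gammaMean, e]
  rw [integral_const_mul, integral_pow_mul_exp_neg_mul_Ioi k hdr, div_pow]
  field_simp

theorem localTimeMean_exp (hd : 0 < d) {r : ℝ} (hr : 0 ≤ r) (t : ℝ) :
    localTimeMean d (fun t => Real.exp (-(r * t))) t
      = d / (d + r) * Real.exp (-(d * r / (d + r) * t)) := by
  have hdr : 0 < d + r := by positivity
  simp only [localTimeMean, gammaMean_exp hd hr]
  rw [poissonMean_eq]
  have e : ∀ k : ℕ, (d * t) ^ k / k ! * (d / (d + r)) ^ (k + 1)
      = d / (d + r) * ((d * t * (d / (d + r))) ^ k / k !) := fun k => by ring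
  simp only [e]
  rw [tsum_mul_left]
  have h := congrFun Real.exp_eq_exp_ℝ (d * t * (d / (d + r)))
  rw [NormedSpace.exp_eq_tsum_div] at h
  change _ = ∑' k : ℕ, (d * t * (d / (d + r))) ^ k / (k ! : ℝ) at h
  rw [← h, mul_left_comm, ← Real.exp_add]
  congr 2
  field_simp
  ring

/-- The function `t ↦ 1 - exp (-θ t)` with `θ = d / (j + d)`. -/
def expCurve (d : ℝ) (j : ℕ) (t : ℝ) : ℝ := 1 - Real.exp (-(d / (j + d) * t))

theorem isBddMeas_expCurve (hd : 0 < d) (j : ℕ) : IsBddMeas (expCurve d j) :=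
  (IsBddMeas.const 1).sub (isBddMeas_exp (by positivity))

theorem localTimeMean_expCurve (hd : 0 < d) (j : ℕ) (t : ℝ) :
    localTimeMean d (expCurve d j) t
      = 1 - (j + d) / (j + d + 1) * Real.exp (-(d / ((j + 1 : ℕ) + d) * t)) := by
  have hr : 0 ≤ d / (j + d) := by positivity
  have e : localTimeMean d (expCurve d j) t = localTimeMean d
      (fun t => (fun _ => (1 : ℝ)) t + (-1) * Real.exp (-(d / (j + d) * t))) t := by
    unfold expCurve; simp only [sub_eq_add_neg, neg_one_mul]
  rw [e, localTimeMean_add hd (IsBddMeas.const 1) ((isBddMeas_exp hr).const_mul _),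
    localTimeMean_const hd, localTimeMean_const_mul, localTimeMean_exp hd hr]
  have hj : (0 : ℝ) ≤ j := by positivity
  have e1 : d / (d + d / (j + d)) = (j + d) / (j + d + 1) := by field_simp
  have e2 : d * (d / (j + d)) / (d + d / (j + d)) = d / ((j + 1 : ℕ) + d) := by
    push_cast
    field_simp
    ring
  rw [e1, e2]
  ring

theorem gammaMean_expCurve (hd : 0 < d) (n j : ℕ) (hn : 1 ≤ n) :
    gammaMean (d / n) 0 (expCurve d j) = n / (j + d + n) := by
  have hn' : (0 : ℝ) < n := by exact_mod_cast hn
  have hr : 0 ≤ d / (j + d) := by positivity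
  have hdn : 0 < d / n := by positivity
  unfold expCurve
  rw [gammaMean_sub hdn 0 (IsBddMeas.const 1) (isBddMeas_exp hr), gammaMean_const hdn,
    gammaMean_exp hdn hr]
  have hj : (0 : ℝ) ≤ j := by positivity
  have hjd : (0 : ℝ) < j + d := by positivity
  have hjdn : (j + d + n : ℝ) ≠ 0 := by positivity
  have e : d / n / (d / n + d / (j + d)) = (j + d) / (j + d + n) := by field_simp
  rw [e, zero_add, pow_one, eq_div_iff hjdn, sub_mul, div_mul_cancel₀ _ hjdn]
  ring

theorem relax_localTimeMean_expCurve (hd : 0 < d) (j : ℕ) :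
    relax 1 0 (localTimeMean d (expCurve d j)) = fun t =>
      (j + d) / (j + 1) * expCurve d (j + 1) t + (1 - d) / (j + 1) * expCurve d 0 t := by
  symm
  refine eq_relax ((isBddMeas_expCurve hd j).continuous_localTimeMean hd) (by simp [expCurve])
    fun t => ?_
  have hexp : ∀ r : ℝ, HasDerivAt (fun t => 1 - Real.exp (-(r * t))) (r * Real.exp (-(r * t))) t :=
    fun r => by
      have hid : HasDerivAt (fun s : ℝ => r * s) (r * 1) t := (hasDerivAt_id t).const_mul r
      convert! hid.fun_neg.exp.const_sub 1 using 1
      ring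
  convert! ((hexp (d / ((j + 1 : ℕ) + d))).const_mul ((j + d) / (j + 1))).add
    ((hexp (d / ((0 : ℕ) + d))).const_mul ((1 - d) / (j + 1))) using 1
  rw [localTimeMean_expCurve hd]
  unfold expCurve
  have hj : (0 : ℝ) ≤ j := by positivity
  generalize Real.exp (-(d / ((j + 1 : ℕ) + d) * t)) = x
  generalize Real.exp (-(d / ((0 : ℕ) + d) * t)) = y
  push_cast
  field_simp
  ring

end Exponentials

/-! ### Local times along a ray, and a subharmonic function -/

section Supercritical
open Set Filter Topology

variable {d : ℝ}

/-- The span of the functions `t ↦ 1 - exp (-θ t)` with `θ = d / (j + d)`. -/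
def expSpan (d : ℝ) : Submodule ℝ (ℝ → ℝ) := Submodule.span ℝ (range (expCurve d))

theorem relax_localTimeMean_add (hd : 0 < d) {F G : ℝ → ℝ} (hF : IsBddMeas F) (hG : IsBddMeas G) :
    relax 1 0 (localTimeMean d (F + G))
      = relax 1 0 (localTimeMean d F) + relax 1 0 (localTimeMean d G) := by
  funext t
  have e : localTimeMean d (F + G) = fun t => localTimeMean d F t + localTimeMean d G t :=
    funext fun t => localTimeMean_add hd hF hG t
  rw [e, Pi.add_apply, ← relax_add 1 0 0 (hF.continuous_localTimeMean hd)
    (hG.continuous_localTimeMean hd), add_zero]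

theorem relax_localTimeMean_smul (c : ℝ) (F : ℝ → ℝ) :
    relax 1 0 (localTimeMean d (c • F)) = c • relax 1 0 (localTimeMean d F) := by
  funext t
  have e : localTimeMean d (c • F) = fun t => c * localTimeMean d F t :=
    funext fun t => localTimeMean_const_mul d c F t
  have := relax_const_mul 1 0 c (localTimeMean d F) t
  rw [mul_zero] at this
  rw [e, this, Pi.smul_apply, smul_eq_mul]

/-- The exponential laws are quasi-invariant under the chain of local times along a ray: started
from the exponential law with rate `d / n`, the chain is not absorbed at `0` in the next step with
probability `n / (n + d)`, and then has the exponential law with rate `d / (n + 1)`. -/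
theorem gammaMean_relax_of_mem_expSpan (hd : 0 < d) {G : ℝ → ℝ} (hG : G ∈ expSpan d) :
    IsBddMeas G ∧ relax 1 0 (localTimeMean d G) ∈ expSpan d ∧ ∀ n : ℕ, 1 ≤ n →
      gammaMean (d / n) 0 (relax 1 0 (localTimeMean d G))
        = n / (n + d) * gammaMean (d / (n + 1 : ℕ)) 0 G := by
  -- boundedness of the image is carried along, so that the means are additive
  suffices h : IsBddMeas G ∧ (relax 1 0 (localTimeMean d G) ∈ expSpan d ∧
      IsBddMeas (relax 1 0 (localTimeMean d G))) ∧ ∀ n : ℕ, 1 ≤ n →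
      gammaMean (d / n) 0 (relax 1 0 (localTimeMean d G))
        = n / (n + d) * gammaMean (d / (n + 1 : ℕ)) 0 G from ⟨h.1, h.2.1.1, h.2.2⟩
  induction hG using Submodule.span_induction with
  | mem G hG =>
    obtain ⟨j, rfl⟩ := hG
    rw [relax_localTimeMean_expCurve hd]
    have hb1 := (isBddMeas_expCurve hd (j + 1)).const_mul ((j + d) / (j + 1))
    have hb0 := (isBddMeas_expCurve hd 0).const_mul ((1 - d) / (j + 1))
    refine ⟨isBddMeas_expCurve hd j, ⟨?_, hb1.add hb0⟩, fun n hn => ?_⟩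
    · exact (expSpan d).add_mem
        ((expSpan d).smul_mem ((j + d) / (j + 1)) (Submodule.subset_span ⟨j + 1, rfl⟩))
        ((expSpan d).smul_mem ((1 - d) / (j + 1)) (Submodule.subset_span ⟨0, rfl⟩))
    · have hn' : (0 : ℝ) < n := by exact_mod_cast hn
      rw [gammaMean_add (by positivity) 0 hb1 hb0, gammaMean_const_mul, gammaMean_const_mul,
        gammaMean_expCurve hd n _ hn, gammaMean_expCurve hd n _ hn,
        gammaMean_expCurve hd (n + 1) _ (by omega)]
      have hj : (0 : ℝ) ≤ j := by positivity
      have h1 : ((j + 1 : ℕ) + d + n : ℝ) ≠ 0 := by positivity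
      have h2 : ((j : ℝ) + d + (n + 1 : ℕ)) ≠ 0 := by positivity
      push_cast at h1 h2 ⊢
      field_simp
      ring
  | zero =>
    have e0 : (0 : ℝ → ℝ) = fun _ => 0 := rfl
    have e : relax 1 0 (localTimeMean d (0 : ℝ → ℝ)) = 0 := by
      have := relax_localTimeMean_smul (d := d) 0 (0 : ℝ → ℝ)
      simpa using this
    rw [e]
    refine ⟨IsBddMeas.const 0, ⟨zero_mem _, IsBddMeas.const 0⟩, fun n hn => ?_⟩
    have hn' : (0 : ℝ) < n := by exact_mod_cast hn
    rw [e0, gammaMean_const (by positivity), gammaMean_const (by positivity), mul_zero]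
  | add F G _ _ hF hG =>
    obtain ⟨hF1, ⟨hF2, hF3⟩, hF4⟩ := hF
    obtain ⟨hG1, ⟨hG2, hG3⟩, hG4⟩ := hG
    rw [relax_localTimeMean_add hd hF1 hG1]
    refine ⟨hF1.add hG1, ⟨add_mem hF2 hG2, hF3.add hG3⟩, fun n hn => ?_⟩
    have hn' : (0 : ℝ) < n := by exact_mod_cast hn
    have a1 := gammaMean_add (d := d / n) (by positivity) 0 hF3 hG3
    have a2 := gammaMean_add (d := d / (n + 1 : ℕ)) (by positivity) 0 hF1 hG1
    calc _ = _ := a1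
      _ = n / (n + d) * (gammaMean (d / (n + 1 : ℕ)) 0 F + gammaMean (d / (n + 1 : ℕ)) 0 G) := by
        rw [hF4 n hn, hG4 n hn, mul_add]
      _ = _ := by rw [← a2]; rfl
  | smul c G _ hG =>
    obtain ⟨hG1, ⟨hG2, hG3⟩, hG4⟩ := hG
    rw [relax_localTimeMean_smul]
    refine ⟨hG1.const_mul c, ⟨Submodule.smul_mem _ _ hG2, hG3.const_mul c⟩, fun n hn => ?_⟩
    calc _ = _ := gammaMean_const_mul (d / n) 0 c _
      _ = n / (n + d) * (c * gammaMean (d / (n + 1 : ℕ)) 0 G) := by rw [hG4 n hn]; ring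
      _ = _ := by rw [← gammaMean_const_mul]; rfl

/-- `survival d n t` is the probability that the chain of local times along a ray, which describes
the once-reinforced random walk on a path, is not absorbed at `0` in its first `n + 1` steps when
started from `t`. -/
def survival (d : ℝ) : ℕ → ℝ → ℝ
  | 0 => fun t => 1 - Real.exp (-t)
  | n + 1 => relax 1 0 (localTimeMean d (survival d n))

theorem survival_zero_eq (hd : 0 < d) : survival d 0 = expCurve d 0 := by
  funext t
  simp [survival, expCurve, hd.ne']

theorem survival_mem_expSpan (hd : 0 < d) (n : ℕ) : survival d n ∈ expSpan d := by
  induction n with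
  | zero => exact survival_zero_eq hd ▸ Submodule.subset_span ⟨0, rfl⟩
  | succ n ih => exact (gammaMean_relax_of_mem_expSpan hd ih).2.1

theorem isBddMeas_survival (hd : 0 < d) (n : ℕ) : IsBddMeas (survival d n) :=
  (gammaMean_relax_of_mem_expSpan hd (survival_mem_expSpan hd n)).1

theorem gammaMean_survival (hd : 0 < d) (n k : ℕ) (hk : 1 ≤ k) :
    gammaMean (d / k) 0 (survival d n)
      = ∏ j ∈ Finset.range (n + 1), ((k + j : ℕ) : ℝ) / ((k + j : ℕ) + d) := by
  induction n generalizing k with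
  | zero =>
    rw [survival_zero_eq hd, gammaMean_expCurve hd k 0 hk]
    simp [add_comm]
  | succ n ih =>
    rw [survival, (gammaMean_relax_of_mem_expSpan hd (survival_mem_expSpan hd n)).2.2 k hk,
      ih (k + 1) (by omega), Finset.prod_range_succ' _ (n + 1), mul_comm]
    refine congrArg₂ _ ?_ (by simp)
    refine Finset.prod_congr rfl fun j _ => ?_
    rw [show k + 1 + j = k + (j + 1) by ring]

/-- The probability that the once-reinforced random walk on a path reaches distance `n + 1`
before it returns to its starting point. -/
def pathSurvival (d : ℝ) (n : ℕ) : ℝ := ∏ j ∈ Finset.range n, ((1 + j : ℕ) : ℝ) / ((1 + j : ℕ) + d)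

theorem localTimeMean_monotoneOn (hd : 0 < d) {F F' : ℝ → ℝ} (hF : IsBddMeas F)
    (hF' : IsBddMeas F') (h : ∀ t, 0 ≤ t → HasDerivAt F (F' t) t) (hpos : ∀ t, 0 ≤ t → 0 ≤ F' t) :
    MonotoneOn (localTimeMean d F) (Ici 0) := by
  obtain ⟨C, hC⟩ := hF.exists_gammaMean_le hd
  have hder := fun t => hasDerivAt_poissonMean d hC t
  have hinc : ∀ k, gammaMean d k F ≤ gammaMean d (k + 1) F := by
    intro k
    have h0 : 0 ≤ gammaMean d (k + 1) F' := by
      rw [← gammaMean_const hd (k + 1) 0]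
      exact gammaMean_mono hd _ (IsBddMeas.const 0) hF' hpos
    rw [gammaMean_succ_deriv hd k hF hF' h] at h0
    linarith [nonneg_of_mul_nonneg_right h0 hd]
  refine monotoneOn_of_deriv_nonneg (convex_Ici 0) (hF.continuous_localTimeMean hd).continuousOn
    (fun t _ => (hder t).differentiableAt.differentiableWithinAt) fun t ht => ?_
  rw [interior_Ici] at ht
  have : deriv (localTimeMean d F) t = _ := (hder t).deriv
  rw [this]
  exact mul_nonneg hd.le (sub_nonneg.2 (poissonMean_mono hd ht.le hC (fun k => hC (k + 1)) hinc))

theorem relax_one_zero_const (c t : ℝ) : relax 1 0 (fun _ => c) t = c * (1 - Real.exp (-t)) := by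
  have := eq_relax (w := 1) (c := 0) (ω := fun _ => c) (f := fun t => c * (1 - Real.exp (-t)))
    continuous_const (by simp) (fun t => by
      convert! ((hasDerivAt_neg t).exp.const_sub 1).const_mul c using 1
      ring)
  exact (congrFun this t).symm

theorem survival_regular (hd : 0 < d) (n : ℕ) :
    (∀ t, 0 ≤ t → 0 ≤ survival d n t ∧ survival d n t ≤ 1) ∧
    (∃ F', IsBddMeas F' ∧ (∀ t, HasDerivAt (survival d n) (F' t) t) ∧ ∀ t, 0 ≤ t → 0 ≤ F' t) := by
  induction n with
  | zero =>
    refine ⟨fun t ht => ?_, fun t => Real.exp (-(1 * t)), isBddMeas_exp zero_le_one, fun t => ?_,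
      fun t _ => (Real.exp_pos _).le⟩
    · simp only [survival]
      have := Real.exp_pos (-t)
      have : Real.exp (-t) ≤ 1 := Real.exp_le_one_iff.2 (by linarith)
      constructor <;> linarith
    · convert! (hasDerivAt_neg t).exp.const_sub 1 using 1
      simp
  | succ n ih =>
    obtain ⟨hb, F', hF', hder, hpos⟩ := ih
    have hn := isBddMeas_survival hd n
    have hK := hn.continuous_localTimeMean hd
    have hmono := localTimeMean_monotoneOn hd hn hF' (fun t _ => hder t) hpos
    have hK0 : ∀ t, 0 ≤ t → 0 ≤ localTimeMean d (survival d n) t := fun t ht => by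
      rw [← localTimeMean_const hd 0 t]
      exact localTimeMean_mono hd (IsBddMeas.const 0) hn (fun s hs => (hb s hs).1) ht
    have hK1 : ∀ t, 0 ≤ t → localTimeMean d (survival d n) t ≤ 1 := fun t ht => by
      rw [← localTimeMean_const hd 1 t]
      exact localTimeMean_mono hd hn (IsBddMeas.const 1) (fun s hs => (hb s hs).2) ht
    have hle : ∀ t, 0 ≤ t → survival d (n + 1) t ≤ localTimeMean d (survival d n) t := by
      intro t ht
      calc survival d (n + 1) t
          ≤ relax 1 (localTimeMean d (survival d n) t)
              (fun _ => localTimeMean d (survival d n) t) t :=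
            relax_mono zero_le_one hK continuous_const ht (hK0 t ht) fun s hs hst =>
              hmono hs ht hst
        _ = _ := relax_const _ _ _
    have hnn : ∀ t, 0 ≤ t → 0 ≤ survival d (n + 1) t := by
      intro t ht
      calc (0 : ℝ) = relax 1 0 (fun _ => 0) t := (relax_const _ _ _).symm
        _ ≤ _ := relax_mono zero_le_one continuous_const hK ht le_rfl fun s hs _ => hK0 s hs
    refine ⟨fun t ht => ⟨hnn t ht, (hle t ht).trans (hK1 t ht)⟩,
      fun t => localTimeMean d (survival d n) t - survival d (n + 1) t,
      (hn.localTimeMean hd).sub (isBddMeas_survival hd (n + 1)), fun t => ?_, fun t ht => ?_⟩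
    · convert! hasDerivAt_relax 1 0 hK t using 1
      rw [one_mul]
      rfl
    · exact sub_nonneg.2 (hle t ht)

/-- The first edge must be crossed; once this has happened, the local time that is still left can
only help. -/
theorem pathSurvival_mul_le_survival (hd : 0 < d) (n : ℕ) {t : ℝ} (ht : 0 ≤ t) :
    pathSurvival d n * (1 - Real.exp (-t)) ≤ survival d n t := by
  cases n with
  | zero => simp [pathSurvival, survival]
  | succ n =>
    obtain ⟨hb, F', hF', hder, hpos⟩ := survival_regular hd n
    have hn := isBddMeas_survival hd n
    have hmono := localTimeMean_monotoneOn hd hn hF' (fun t _ => hder t) hpos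
    have h0 : localTimeMean d (survival d n) 0 = pathSurvival d (n + 1) := by
      rw [localTimeMean, poissonMean_zero, pathSurvival, ← gammaMean_survival hd n 1 le_rfl]
      simp
    rw [← relax_one_zero_const, survival]
    refine relax_mono zero_le_one continuous_const (hn.continuous_localTimeMean hd) ht le_rfl
      fun s hs _ => ?_
    rw [← h0]
    exact hmono self_mem_Ici hs hs

/-- The survival probability on a path decays subexponentially. -/
theorem exists_one_le_pow_mul_pathSurvival (hd : 0 < d) {m : ℝ} (hm : 1 < m) :
    ∃ n, 1 ≤ n ∧ 1 ≤ m ^ n * pathSurvival d n := by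
  obtain ⟨r, hr1, hrm⟩ := exists_between hm
  have hpos : ∀ n, 0 < m ^ n * pathSurvival d n := fun n => by
    have : 0 < pathSurvival d n := Finset.prod_pos fun j _ => by positivity
    positivity
  obtain ⟨n₀, hn₀⟩ := exists_nat_gt (r * d / (m - r))
  rw [div_lt_iff₀ (sub_pos.2 hrm)] at hn₀
  have hratio : ∀ n, r * (m ^ (n₀ + n) * pathSurvival d (n₀ + n))
      ≤ m ^ (n₀ + (n + 1)) * pathSurvival d (n₀ + (n + 1)) := by
    intro n
    have e : m ^ (n₀ + (n + 1)) * pathSurvival d (n₀ + (n + 1))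
        = m * (((1 + (n₀ + n) : ℕ) : ℝ) / ((1 + (n₀ + n) : ℕ) + d))
          * (m ^ (n₀ + n) * pathSurvival d (n₀ + n)) := by
      rw [pathSurvival, ← add_assoc, Finset.prod_range_succ, pathSurvival]
      ring
    rw [e]
    refine mul_le_mul_of_nonneg_right ?_ (hpos _).le
    rw [mul_div_assoc', le_div_iff₀ (by positivity)]
    have hn : (0 : ℝ) ≤ n := by positivity
    push_cast
    nlinarith [mul_nonneg hn (sub_pos.2 hrm).le]
  have ht := tendsto_atTop_of_geom_le (hpos _) hr1 hratio
  obtain ⟨n, hn, hn1⟩ := ((ht.eventually_ge_atTop 1).and (eventually_ge_atTop 1)).exists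
  exact ⟨n₀ + n, by omega, hn⟩

/-- If the branching number `m` exceeds `1`, the branching chain of local times has a positive
subharmonic function. -/
theorem exists_subharmonic (hd : 0 < d) {m : ℝ} (hm : 1 < m) :
    ∃ H : ℝ → ℝ, IsBddMeas H ∧ (∀ t, 0 ≤ t → 0 ≤ H t) ∧ 0 < H 1 ∧
      ∀ t, 0 ≤ t → H t ≤ m * relax 1 0 (localTimeMean d H) t := by
  obtain ⟨N, hN1, hN⟩ := exists_one_le_pow_mul_pathSurvival hd hm
  have hm0 : 0 < m := by linarith
  -- a truncated resolvent: with `G = survival d` and `K G = relax 1 0 (localTimeMean d G)`,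
  -- `m * K H` telescopes to `H - G 0 + m ^ N * G N`
  set H : ℕ → ℝ → ℝ := fun n => ∑ k ∈ Finset.range n, m ^ k • survival d k with hH
  have hHs : ∀ n, H (n + 1) = H n + m ^ n • survival d n := fun n => Finset.sum_range_succ _ n
  have hHb : ∀ n, IsBddMeas (H n) := fun n => by
    induction n with
    | zero => exact IsBddMeas.const 0
    | succ n ih => rw [hHs]; exact ih.add ((isBddMeas_survival hd n).const_mul _)
  have hK : ∀ n, m • relax 1 0 (localTimeMean d (H n)) = H (n + 1) - survival d 0 := fun n => by
    induction n with
    | zero =>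
      have := relax_localTimeMean_smul (d := d) 0 (0 : ℝ → ℝ)
      simp only [zero_smul] at this
      simp [hH, this]
    | succ n ih =>
      have hb : IsBddMeas (m ^ n • survival d n) := (isBddMeas_survival hd n).const_mul _
      rw [hHs n, relax_localTimeMean_add hd (hHb n) hb, smul_add, ih, relax_localTimeMean_smul,
        hHs (n + 1), smul_smul, pow_succ', survival]
      abel
  have hnn : ∀ n t, 0 ≤ t → 0 ≤ H n t := fun n t ht => by
    simp only [hH, Finset.sum_apply, Pi.smul_apply, smul_eq_mul]
    exact Finset.sum_nonneg fun k _ =>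
      mul_nonneg (pow_pos hm0 k).le ((survival_regular hd k).1 t ht).1
  have hKN : ∀ n t, m * relax 1 0 (localTimeMean d (H n)) t
      = H n t + m ^ n * survival d n t - survival d 0 t := fun n t => by
    have := congrFun (hK n) t
    rw [hHs] at this
    simpa using this
  have hle : ∀ t, 0 ≤ t → survival d 0 t ≤ m ^ N * survival d N t := fun t ht => by
    have h0 : 0 ≤ survival d 0 t := ((survival_regular hd 0).1 t ht).1
    calc survival d 0 t ≤ m ^ N * pathSurvival d N * survival d 0 t :=
          le_mul_of_one_le_left h0 hN
      _ = m ^ N * (pathSurvival d N * survival d 0 t) := mul_assoc _ _ _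
      _ ≤ _ := mul_le_mul_of_nonneg_left (pathSurvival_mul_le_survival hd N ht) (by positivity)
  refine ⟨H N, hHb N, hnn N, ?_, fun t ht => ?_⟩
  · simp only [hH, Finset.sum_apply, Pi.smul_apply, smul_eq_mul]
    refine Finset.sum_pos' (fun k _ => mul_nonneg (pow_pos hm0 k).le
      ((survival_regular hd k).1 1 zero_le_one).1) ⟨0, Finset.mem_range.2 hN1, ?_⟩
    simp [survival]
  · rw [hKN]
    linarith [hle t ht]

end Supercritical

/-! ### The local time at a child as a density -/

section EdgeOperator
open Set Filter Topology

variable {d : ℝ}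

/-- The density of the local time at a child, on the event that it is positive, when the local time
at the parent is `t`: the edge to the child is first crossed at an exponential time with rate `1`,
after that at rate `d`, and every visit to the child lasts for an exponential time with rate `d`. -/
def childDensity (d t s : ℝ) : ℝ≥0∞ :=
  ∫⁻ r in Ioi 0, (if r ≤ t then ENNReal.ofReal (Real.exp (-(t - r))) else 0) *
    ∑' k, ENNReal.ofReal (poissonWeight d r k) * ENNReal.ofReal (gammaDensity d k s)

/-- The probability, in terms of the local time `t` at the parent, that no excursion into a subtree
escapes, if `F s` is that probability in terms of the local time `s` at the root of the subtree. -/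
def edgeMean (d : ℝ) (F : ℝ → ℝ≥0∞) (t : ℝ) : ℝ≥0∞ :=
  ENNReal.ofReal (Real.exp (-t)) + ∫⁻ s in Ioi 0, childDensity d t s * F s

theorem measurable_ofReal_poissonWeight (d : ℝ) (k : ℕ) :
    Measurable fun r => ENNReal.ofReal (poissonWeight d r k) :=
  (continuous_poissonWeight d k).measurable.ennreal_ofReal

theorem measurable_ofReal_gammaDensity (d : ℝ) (k : ℕ) :
    Measurable fun s => ENNReal.ofReal (gammaDensity d k s) :=
  (continuous_gammaDensity d k).measurable.ennreal_ofReal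

theorem measurable_clock : Measurable fun z : ℝ × ℝ =>
    if z.2 ≤ z.1 then ENNReal.ofReal (Real.exp (-(z.1 - z.2))) else 0 :=
  Measurable.ite (measurableSet_le measurable_snd measurable_fst) (by fun_prop) measurable_const

theorem measurable_childDensity (d : ℝ) : Measurable fun z : ℝ × ℝ => childDensity d z.1 z.2 := by
  unfold childDensity
  refine Measurable.lintegral_prod_right' (f := fun y : (ℝ × ℝ) × ℝ =>
    (if y.2 ≤ y.1.1 then ENNReal.ofReal (Real.exp (-(y.1.1 - y.2))) else 0) *
      ∑' k, ENNReal.ofReal (poissonWeight d y.2 k) * ENNReal.ofReal (gammaDensity d k y.1.2)) ?_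
  refine Measurable.mul ?_ (Measurable.tsum fun k => ?_)
  · exact measurable_clock.comp ((measurable_fst.comp measurable_fst).prodMk measurable_snd)
  · exact ((measurable_ofReal_poissonWeight d k).comp measurable_snd).mul
      ((measurable_ofReal_gammaDensity d k).comp (measurable_snd.comp measurable_fst))

theorem edgeMean_mono {F G : ℝ → ℝ≥0∞} (h : ∀ s, 0 ≤ s → F s ≤ G s) (t : ℝ) :
    edgeMean d F t ≤ edgeMean d G t := by
  refine add_le_add_right (setLIntegral_mono' measurableSet_Ioi fun s hs => ?_) _
  exact mul_le_mul_right (h s (le_of_lt hs)) _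

theorem edgeMean_iSup {F : ℕ → ℝ → ℝ≥0∞} (hF : ∀ n, Measurable (F n)) (hmono : Monotone F)
    (t : ℝ) : edgeMean d (fun s => ⨆ n, F n s) t = ⨆ n, edgeMean d (F n) t := by
  unfold edgeMean
  rw [← ENNReal.add_iSup]
  congr 1
  simp only [ENNReal.mul_iSup]
  refine lintegral_iSup (fun n => ?_) fun i j hij s => mul_le_mul_right (hmono hij s) _
  exact ((measurable_childDensity d).comp (measurable_const.prodMk measurable_id)).mul (hF n)

theorem measurable_edgeMean {Ω : Type*} [MeasurableSpace Ω] {F : Ω → ℝ → ℝ≥0∞}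
    (hF : Measurable fun z : Ω × ℝ => F z.1 z.2) :
    Measurable fun z : Ω × ℝ => edgeMean d (F z.1) z.2 := by
  unfold edgeMean
  have he : Measurable fun z : Ω × ℝ => ENNReal.ofReal (Real.exp (-z.2)) := by fun_prop
  refine he.add ?_
  refine Measurable.lintegral_prod_right' (f := fun y : (Ω × ℝ) × ℝ =>
    childDensity d y.1.2 y.2 * F y.1.1 y.2) ?_
  exact ((measurable_childDensity d).comp
    ((measurable_snd.comp measurable_fst).prodMk measurable_snd)).mul
    (hF.comp ((measurable_fst.comp measurable_fst).prodMk measurable_snd))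

theorem lintegral_edgeMean {Ω : Type*} [MeasurableSpace Ω] (P : Measure Ω) [IsProbabilityMeasure P]
    {F : Ω → ℝ → ℝ≥0∞} (hF : Measurable fun z : Ω × ℝ => F z.1 z.2) (t : ℝ) :
    ∫⁻ ω, edgeMean d (F ω) t ∂P = edgeMean d (fun s => ∫⁻ ω, F ω s ∂P) t := by
  have hρ : Measurable fun s => childDensity d t s :=
    (measurable_childDensity d).comp (measurable_const.prodMk measurable_id)
  have hm : Measurable fun z : Ω × ℝ => childDensity d t z.2 * F z.1 z.2 :=
    (hρ.comp measurable_snd).mul hF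
  unfold edgeMean
  rw [lintegral_add_left measurable_const, lintegral_const, measure_univ, mul_one,
    lintegral_lintegral_swap hm.aemeasurable]
  congr 1
  refine lintegral_congr fun s => ?_
  have hs : Measurable fun ω => F ω s := hF.comp (measurable_id.prodMk measurable_const)
  exact lintegral_const_mul _ hs

/-- The two descriptions of the escape through an edge: by the density of the local time at the
child, and by the differential equation in the local time at the parent. -/
theorem edgeMean_ofReal (hd : 0 < d) {F : ℝ → ℝ} (hF : IsBddMeas F) (h0 : ∀ t, 0 ≤ t → 0 ≤ F t)
    {t : ℝ} (ht : 0 ≤ t) :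
    edgeMean d (fun s => ENNReal.ofReal (F s)) t
      = ENNReal.ofReal (relax 1 1 (localTimeMean d F) t) := by
  have hFm : Measurable fun s => ENNReal.ofReal (F s) := hF.meas.ennreal_ofReal
  have hgamma : ∀ k, ∫⁻ s in Ioi 0, ENNReal.ofReal (gammaDensity d k s) * ENNReal.ofReal (F s)
      = ENNReal.ofReal (gammaMean d k F) := by
    intro k
    rw [gammaMean, ofReal_integral_eq_lintegral_ofReal (hF.integrableOn_gamma hd k)]
    · refine setLIntegral_congr_fun measurableSet_Ioi fun s hs => ?_
      exact (ENNReal.ofReal_mul (gammaDensity_nonneg hd k (le_of_lt hs))).symm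
    · exact (ae_restrict_mem measurableSet_Ioi).mono fun s hs =>
        mul_nonneg (gammaDensity_nonneg hd k (le_of_lt hs)) (h0 s (le_of_lt hs))
  have hgnn : ∀ k, 0 ≤ gammaMean d k F := fun k => by
    rw [← gammaMean_const hd k 0]
    exact gammaMean_mono hd k (IsBddMeas.const 0) hF h0
  obtain ⟨C, hC⟩ := hF.exists_gammaMean_le hd
  have hpoisson : ∀ r, 0 ≤ r → ∑' k, ENNReal.ofReal (poissonWeight d r k) *
      ENNReal.ofReal (gammaMean d k F) = ENNReal.ofReal (localTimeMean d F r) := by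
    intro r hr
    rw [localTimeMean, poissonMean, ENNReal.ofReal_tsum_of_nonneg
      (fun k => mul_nonneg (poissonWeight_nonneg hd hr k) (hgnn k))
      (summable_poissonWeight_mul d r hC)]
    exact tsum_congr fun k => (ENNReal.ofReal_mul (poissonWeight_nonneg hd hr k)).symm
  have hKnn : ∀ r, 0 ≤ r → 0 ≤ localTimeMean d F r := fun r hr => by
    rw [← localTimeMean_const hd 0 r]
    exact localTimeMean_mono hd (IsBddMeas.const 0) hF h0 hr
  have hKc := hF.continuous_localTimeMean hd
  have hswap : ∫⁻ s in Ioi 0, childDensity d t s * ENNReal.ofReal (F s)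
      = ∫⁻ r in Ioi 0, (if r ≤ t then ENNReal.ofReal (Real.exp (-(t - r))) else 0) *
        ENNReal.ofReal (localTimeMean d F r) := by
    have hm : Measurable fun y : ℝ × ℝ =>
        ((if y.2 ≤ t then ENNReal.ofReal (Real.exp (-(t - y.2))) else 0) *
          ∑' k, ENNReal.ofReal (poissonWeight d y.2 k) *
            ENNReal.ofReal (gammaDensity d k y.1)) := by
      refine Measurable.mul ?_ (Measurable.tsum fun k => ?_)
      · exact measurable_clock.comp (measurable_const.prodMk measurable_snd)
      · exact ((measurable_ofReal_poissonWeight d k).comp measurable_snd).mul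
          ((measurable_ofReal_gammaDensity d k).comp measurable_fst)
    have h1 : ∀ s, childDensity d t s * ENNReal.ofReal (F s) = ∫⁻ r in Ioi 0,
        ((if r ≤ t then ENNReal.ofReal (Real.exp (-(t - r))) else 0) *
        ∑' k, ENNReal.ofReal (poissonWeight d r k) * ENNReal.ofReal (gammaDensity d k s)) *
        ENNReal.ofReal (F s) := fun s => by
      exact (lintegral_mul_const _ (hm.comp (measurable_const.prodMk measurable_id))).symm
    simp only [h1]
    rw [lintegral_lintegral_swap (hm.mul (hFm.comp measurable_fst)).aemeasurable]
    refine setLIntegral_congr_fun measurableSet_Ioi fun r hr => ?_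
    have h2 : ∀ k, Measurable fun s => ENNReal.ofReal (poissonWeight d r k) *
        (ENNReal.ofReal (gammaDensity d k s) * ENNReal.ofReal (F s)) := fun k =>
      ((measurable_ofReal_gammaDensity d k).mul hFm).const_mul _
    simp only [mul_assoc, ← ENNReal.tsum_mul_right]
    rw [lintegral_const_mul _ (Measurable.tsum h2),
      lintegral_tsum fun k => (h2 k).aemeasurable, ← hpoisson r (le_of_lt hr)]
    congr 1
    refine tsum_congr fun k => ?_
    rw [← hgamma]
    exact lintegral_const_mul _ ((measurable_ofReal_gammaDensity d k).mul hFm)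
  have hint : ∫⁻ r in Ioi 0, (if r ≤ t then ENNReal.ofReal (Real.exp (-(t - r))) else 0) *
        ENNReal.ofReal (localTimeMean d F r)
      = ENNReal.ofReal (∫ r in (0 : ℝ)..t, Real.exp (-(t - r)) * localTimeMean d F r) := by
    have hc : Continuous fun r => Real.exp (-(t - r)) * localTimeMean d F r := by fun_prop
    rw [intervalIntegral.integral_of_le ht,
      ofReal_integral_eq_lintegral_ofReal (hc.integrableOn_Ioc)]
    · have e : Ioc 0 t = Iic t ∩ Ioi 0 := by ext; simp [and_comm]
      rw [e, ← Measure.restrict_restrict measurableSet_Iic, ← lintegral_indicator measurableSet_Iic]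
      refine lintegral_congr fun r => ?_
      by_cases hr : r ≤ t
      · simp [hr, ENNReal.ofReal_mul (Real.exp_pos _).le]
      · simp [hr]
    · exact (ae_restrict_mem measurableSet_Ioc).mono fun r hr =>
        mul_nonneg (Real.exp_pos _).le (hKnn r hr.1.le)
  rw [edgeMean, hswap, hint, ← ENNReal.ofReal_add (Real.exp_pos _).le]
  · congr 1
    unfold relax
    rw [mul_add, mul_one, one_mul, ← intervalIntegral.integral_const_mul]
    congr 1
    refine intervalIntegral.integral_congr fun r _ => ?_
    simp only [one_mul]
    rw [← mul_assoc, ← Real.exp_add]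
    congr 2
    ring
  · exact intervalIntegral.integral_nonneg ht fun r hr =>
      mul_nonneg (Real.exp_pos _).le (hKnn r hr.1)

end EdgeOperator

/-! ### Generating functions and the annealed return probability -/

section Offspring
open Set Filter Topology

/-- The generating function of an offspring law. -/
def offspringGen (p : PMF ℕ) (x : ℝ≥0∞) : ℝ≥0∞ := ∑' b, p b * x ^ b

theorem offspringGen_mono (p : PMF ℕ) : Monotone (offspringGen p) := fun _ _ h =>
  ENNReal.tsum_le_tsum fun b => mul_le_mul_right (pow_le_pow_left' h b) _

theorem one_sub_pow_le {x : ℝ} (hx0 : 0 ≤ x) (hx1 : x ≤ 1) (b : ℕ) :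
    (1 - x) ^ b ≤ 1 - b * x + b ^ 2 * x ^ 2 := by
  induction b with
  | zero => simp
  | succ b ih =>
    have hb : (0 : ℝ) ≤ b := by positivity
    calc (1 - x) ^ (b + 1) = (1 - x) ^ b * (1 - x) := pow_succ _ _
      _ ≤ (1 - b * x + b ^ 2 * x ^ 2) * (1 - x) :=
        mul_le_mul_of_nonneg_right ih (by linarith)
      _ ≤ _ := by
        push_cast
        nlinarith [mul_nonneg hb (sq_nonneg x), mul_nonneg (sq_nonneg (b : ℝ)) (pow_nonneg hx0 3),
          sq_nonneg x]

/-- Near `1`, the generating function of a law with mean greater than `1` has slope greater than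
`1`. -/
theorem exists_offspringGen_le (p : PMF ℕ) (hm : 1 < offspringMean p) :
    ∃ m ε : ℝ, 1 < m ∧ 0 < ε ∧ m * ε ≤ 1 ∧ ∀ x, 0 ≤ x → x ≤ ε →
      offspringGen p (ENNReal.ofReal (1 - x)) ≤ ENNReal.ofReal (1 - m * x) := by
  unfold offspringMean at hm
  rw [ENNReal.tsum_eq_iSup_sum, lt_iSup_iff] at hm
  obtain ⟨s, hs⟩ := hm
  set q : ℕ → ℝ := fun b => (p b).toReal with hq
  have hq0 : ∀ b, 0 ≤ q b := fun b => ENNReal.toReal_nonneg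
  have hpq : ∀ b, p b = ENNReal.ofReal (q b) := fun b =>
    (ENNReal.ofReal_toReal (p.apply_ne_top b)).symm
  have hqs : Summable q := ENNReal.summable_toReal (by simp [p.tsum_coe])
  have hq1 : ∑' b, q b = 1 := by
    rw [hq, ← ENNReal.tsum_toReal_eq p.apply_ne_top, p.tsum_coe, ENNReal.toReal_one]
  set M := ∑ b ∈ s, q b * b with hM
  set B := ∑ b ∈ s, q b * (b : ℝ) ^ 2 with hB
  have hB0 : 0 ≤ B := Finset.sum_nonneg fun b _ => mul_nonneg (hq0 b) (by positivity)
  have hM1 : 1 < M := by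
    have e : ∑ b ∈ s, p b * (b : ℝ≥0∞) = ENNReal.ofReal M := by
      rw [hM, ENNReal.ofReal_sum_of_nonneg fun b _ => mul_nonneg (hq0 b) (by positivity)]
      refine Finset.sum_congr rfl fun b _ => ?_
      rw [ENNReal.ofReal_mul (hq0 b), ← hpq, ENNReal.ofReal_natCast]
    rw [e] at hs
    simpa using hs
  set m := (1 + M) / 2 with hmdef
  have hm1 : 1 < m := by linarith
  have hmM : m < M := by linarith
  refine ⟨m, min (1 / m) ((M - m) / (B + 1)), hm1,
    lt_min (by positivity) (div_pos (by linarith) (by linarith)), ?_, fun x hx0 hx => ?_⟩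
  · calc m * min (1 / m) ((M - m) / (B + 1)) ≤ m * (1 / m) :=
          mul_le_mul_of_nonneg_left (min_le_left _ _) (by linarith)
      _ = 1 := by field_simp
  · have hx1 : x ≤ 1 := by
      refine (hx.trans (min_le_left _ _)).trans ?_
      rw [div_le_one (by linarith)]
      exact hm1.le
    have hBx : B * x ≤ M - m := by
      have := hx.trans (min_le_right _ _)
      rw [le_div_iff₀ (by linarith)] at this
      nlinarith
    have hy0 : 0 ≤ 1 - x := by linarith
    have hpow : ∀ b : ℕ, (1 - x) ^ b ≤ 1 := fun b => pow_le_one₀ hy0 (by linarith)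
    have hsum : Summable fun b => q b * (1 - x) ^ b :=
      .of_nonneg_of_le (fun b => mul_nonneg (hq0 b) (pow_nonneg hy0 b))
        (fun b => mul_le_of_le_one_right (hq0 b) (hpow b)) hqs
    have e : offspringGen p (ENNReal.ofReal (1 - x))
        = ENNReal.ofReal (∑' b, q b * (1 - x) ^ b) := by
      rw [offspringGen, ENNReal.ofReal_tsum_of_nonneg
        (fun b => mul_nonneg (hq0 b) (pow_nonneg hy0 b)) hsum]
      refine tsum_congr fun b => ?_
      rw [ENNReal.ofReal_mul (hq0 b), ← hpq, ENNReal.ofReal_pow hy0]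
    rw [e]
    refine ENNReal.ofReal_le_ofReal ?_
    have h1 : ∑ b ∈ s, (q b - q b * (1 - x) ^ b) ≤ ∑' b, (q b - q b * (1 - x) ^ b) :=
      (hqs.sub hsum).sum_le_tsum s fun b _ =>
        sub_nonneg.2 (mul_le_of_le_one_right (hq0 b) (hpow b))
    rw [hqs.tsum_sub hsum, hq1] at h1
    -- a finite part `s` of the law already has mean `M > 1` and a finite second moment `B`
    have h2 : M * x - B * x ^ 2 ≤ ∑ b ∈ s, (q b - q b * (1 - x) ^ b) := by
      rw [hM, hB, Finset.sum_mul, Finset.sum_mul, ← Finset.sum_sub_distrib]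
      refine Finset.sum_le_sum fun b _ => ?_
      have := mul_le_mul_of_nonneg_left (one_sub_pow_le hx0 hx1 b) (hq0 b)
      nlinarith
    nlinarith

/-- The annealed probability that no excursion through an edge reaches the upper end of an edge `n`
generations further down, in terms of the local time at the upper end of the first edge. -/
def annealedReturn (p : PMF ℕ) (d : ℝ) : ℕ → ℝ → ℝ≥0∞
  | 0 => fun _ => 0
  | n + 1 => edgeMean d fun s => offspringGen p (annealedReturn p d n s)

/-- The survival probability of the branching chain of local times is bounded below: a small
multiple `h` of the subharmonic function stays below it, as one more generation replaces `1 - h` by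
at most `1 - m * K h`, where `K h` is `relax 1 0 (localTimeMean d h)`. -/
theorem exists_annealedReturn_le (p : PMF ℕ) (hm : 1 < offspringMean p) {d : ℝ} (hd : 0 < d) :
    ∃ c : ℝ, 0 < c ∧ ∀ n, annealedReturn p d n 1 ≤ ENNReal.ofReal (1 - c) := by
  obtain ⟨m, ε, hm1, hε, hmε, hgen⟩ := exists_offspringGen_le p hm
  obtain ⟨H, hH, hH0, hH1, hsub⟩ := exists_subharmonic hd hm1
  obtain ⟨C, hC⟩ := hH.bdd
  have hCpos : 0 < C := hH1.trans_le ((le_abs_self _).trans (hC 1 zero_le_one))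
  set h : ℝ → ℝ := fun t => ε / C * H t with hh
  have hhb : IsBddMeas h := hH.const_mul _
  have hh0 : ∀ t, 0 ≤ t → 0 ≤ h t := fun t ht => mul_nonneg (by positivity) (hH0 t ht)
  have hhε : ∀ t, 0 ≤ t → h t ≤ ε := fun t ht => by
    calc h t ≤ ε / C * C :=
          mul_le_mul_of_nonneg_left ((le_abs_self _).trans (hC t ht)) (by positivity)
      _ = ε := by field_simp
  have hhsub : ∀ t, 0 ≤ t → h t ≤ m * relax 1 0 (localTimeMean d h) t := fun t ht => by
    have e : localTimeMean d h = fun t => ε / C * localTimeMean d H t :=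
      funext fun t => localTimeMean_const_mul d _ H t
    have e2 := relax_const_mul 1 0 (ε / C) (localTimeMean d H) t
    rw [mul_zero] at e2
    rw [e, e2, mul_left_comm]
    exact mul_le_mul_of_nonneg_left (hsub t ht) (by positivity)
  have key : ∀ n t, 0 ≤ t → annealedReturn p d n t ≤ ENNReal.ofReal (1 - h t) := by
    intro n
    induction n with
    | zero => exact fun t _ => zero_le
    | succ n ih =>
      intro t ht
      have hb : IsBddMeas fun s => 1 + (-m) * h s := (IsBddMeas.const 1).add (hhb.const_mul _)
      have hK : localTimeMean d (fun s => 1 + (-m) * h s)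
          = fun s => 1 + (-m) * localTimeMean d h s := funext fun s => by
        rw [localTimeMean_add hd (IsBddMeas.const 1) (hhb.const_mul _), localTimeMean_const hd,
          localTimeMean_const_mul]
      have hr : relax 1 1 (localTimeMean d fun s => 1 + (-m) * h s) t
          = 1 - m * relax 1 0 (localTimeMean d h) t := by
        have hc := hhb.continuous_localTimeMean hd
        have h1 := relax_add 1 1 ((-m) * 0) (ω := fun _ => 1)
          (ω' := fun s => (-m) * localTimeMean d h s) continuous_const (by fun_prop) t
        rw [relax_const, relax_const_mul, mul_zero, add_zero] at h1
        rw [hK, h1]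
        ring
      calc annealedReturn p d (n + 1) t
          ≤ edgeMean d (fun s => ENNReal.ofReal (1 + (-m) * h s)) t := by
            refine edgeMean_mono (fun s hs => ?_) t
            refine (offspringGen_mono p (ih s hs)).trans ((hgen _ (hh0 s hs) (hhε s hs)).trans ?_)
            rw [neg_mul, ← sub_eq_add_neg]
        _ = ENNReal.ofReal (1 - m * relax 1 0 (localTimeMean d h) t) := by
            rw [edgeMean_ofReal hd hb (fun s hs => ?_) ht, hr]
            have := mul_le_mul_of_nonneg_left (hhε s hs) (by linarith : (0 : ℝ) ≤ m)
            linarith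
        _ ≤ _ := ENNReal.ofReal_le_ofReal (by linarith [hhsub t ht])
  exact ⟨h 1, mul_pos (by positivity) hH1, fun n => key n 1 zero_le_one⟩

end Offspring

/-! ### The branching property and the quenched return probability -/

section Branching
open Set Filter Topology

variable {d : ℝ}

/-- The numbers of children in the subtree of the descendants of `v`. -/
def subtree (N : List ℕ → ℕ) (v : List ℕ) : List ℕ → ℕ := fun u => N (u ++ v)

theorem subtree_subtree (N : List ℕ → ℕ) (v : List ℕ) (i : ℕ) :
    subtree (subtree N v) [i] = subtree N (i :: v) := by
  funext u
  simp [subtree]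

theorem measurable_subtree (v : List ℕ) : Measurable fun N : List ℕ → ℕ => subtree N v :=
  measurable_pi_lambda _ fun u => measurable_pi_apply (u ++ v)

theorem indepFun_root_subtrees (p : PMF ℕ) :
    IndepFun (fun N : List ℕ → ℕ => N []) (fun N i => subtree N [i]) (offspringLaw p) := by
  have h := iIndepFun_infinitePi (ι := List ℕ) (P := fun _ => p.toMeasure)
    (X := fun _ x => x) (fun _ => measurable_id)
  have key := indep_iSup_of_disjoint (S := {[]}) (T := {[]}ᶜ)
    (fun v : List ℕ => (measurable_pi_apply v).comap_le) h disjoint_compl_right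
  refine indep_of_indep_of_le_left (indep_of_indep_of_le_right key ?_) ?_
  · simp only [MeasurableSpace.pi, MeasurableSpace.comap_iSup, MeasurableSpace.comap_comp]
    refine iSup_le fun i => iSup_le fun u => ?_
    exact le_iSup₂_of_le (u ++ [i]) (by simp) le_rfl
  · exact le_iSup₂_of_le [] (by simp) le_rfl

theorem map_subtrees (p : PMF ℕ) :
    (offspringLaw p).map (fun N (i : ℕ) => subtree N [i])
      = Measure.infinitePi fun _ : ℕ => offspringLaw p := by
  have hinj : Function.Injective fun q : ℕ × List ℕ => q.2 ++ [q.1] := by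
    rintro ⟨i, u⟩ ⟨j, v⟩ h
    obtain ⟨h1, h2⟩ := List.append_inj' h rfl
    simp_all
  have h1 := Measure.map_infinitePi_infinitePi_of_inj (P := fun _ : List ℕ => p.toMeasure) hinj
  have h2 := Measure.infinitePi_map_curry (fun (_ : ℕ) (_ : List ℕ) => p.toMeasure)
  rw [← h1, Measure.map_map (by fun_prop) (by fun_prop)] at h2
  exact h2

theorem map_subtree (p : PMF ℕ) (i : ℕ) :
    (offspringLaw p).map (fun N => subtree N [i]) = offspringLaw p := by
  have h := congrArg (Measure.map fun M : ℕ → List ℕ → ℕ => M i) (map_subtrees p)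
  rw [Measure.map_map (by fun_prop) (measurable_pi_lambda _ fun i => measurable_subtree [i]),
    Measure.infinitePi_map_eval (fun _ : ℕ => offspringLaw p) i] at h
  exact h

theorem iIndepFun_subtrees (p : PMF ℕ) :
    iIndepFun (fun (i : ℕ) (N : List ℕ → ℕ) => subtree N [i]) (offspringLaw p) := by
  rw [iIndepFun_iff_map_fun_eq_infinitePi_map fun i => measurable_subtree [i], map_subtrees]
  simp only [map_subtree]

/-- The branching property. -/
theorem lintegral_prod_subtrees (p : PMF ℕ) {f : (List ℕ → ℕ) → ℝ≥0∞} (hf : Measurable f) :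
    ∫⁻ N, ∏ i ∈ Finset.range (N []), f (subtree N [i]) ∂(offspringLaw p)
      = offspringGen p (∫⁻ N, f N ∂(offspringLaw p)) := by
  have hsub : ∀ i, ∫⁻ N, f (subtree N [i]) ∂(offspringLaw p) = ∫⁻ N, f N ∂(offspringLaw p) := by
    intro i
    conv_rhs => rw [← map_subtree p i, lintegral_map hf (measurable_subtree [i])]
  have hdec : ∀ N : List ℕ → ℕ, ∏ i ∈ Finset.range (N []), f (subtree N [i])
      = ∑' b, ({b} : Set ℕ).indicator 1 (N []) * ∏ i ∈ Finset.range b, f (subtree N [i]) := by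
    intro N
    rw [tsum_eq_single (N [])]
    · simp
    · intro b hb
      simp [hb.symm]
  have hm1 : ∀ b : ℕ, Measurable (({b} : Set ℕ).indicator (1 : ℕ → ℝ≥0∞)) := fun b =>
    measurable_of_countable _
  have hm2 : ∀ b : ℕ, Measurable fun M : ℕ → List ℕ → ℕ => ∏ i ∈ Finset.range b, f (M i) :=
    fun b => Finset.measurable_prod _ fun i _ => hf.comp (measurable_pi_apply i)
  have hmr : Measurable fun N : List ℕ → ℕ => N [] := measurable_pi_apply []
  have hms : Measurable fun (N : List ℕ → ℕ) (i : ℕ) => subtree N [i] :=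
    measurable_pi_lambda _ fun i => measurable_subtree [i]
  simp only [hdec]
  refine (lintegral_tsum fun b =>
    (((hm1 b).comp hmr).mul ((hm2 b).comp hms)).aemeasurable).trans ?_
  refine tsum_congr fun b => ?_
  have hind := (indepFun_root_subtrees p).comp (hm1 b) (hm2 b)
  have h1 := lintegral_mul_eq_lintegral_mul_lintegral_of_indepFun ((hm1 b).comp hmr)
    ((hm2 b).comp hms) hind
  have h2 := lintegral_prod_eq_prod_lintegral_of_indepFun (Finset.range b)
    (fun i N => f (subtree N [i])) ((iIndepFun_subtrees p).comp (fun _ => f) fun _ => hf)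
    (fun i => hf.comp (measurable_subtree [i]))
  have h3 : ∫⁻ N, ({b} : Set ℕ).indicator 1 (N []) ∂(offspringLaw p) = p b := by
    have e : (offspringLaw p).map (fun N => N []) = p.toMeasure :=
      Measure.infinitePi_map_eval (fun _ : List ℕ => p.toMeasure) []
    rw [← lintegral_map (hm1 b) hmr, e, lintegral_indicator_one (measurableSet_singleton b),
      p.toMeasure_apply_singleton _ (measurableSet_singleton b)]
  rw [← h3]
  refine h1.trans ?_
  congr 1
  refine h2.trans ?_
  simp [hsub]

/-- The quenched probability that no excursion through an edge above the root reaches the upper end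
of an edge `n` generations further down, in terms of the local time at the upper end of the first
edge. -/
def quenchedReturn (d : ℝ) : ℕ → (List ℕ → ℕ) → ℝ → ℝ≥0∞
  | 0, _ => fun _ => 0
  | n + 1, N => edgeMean d fun s =>
      ∏ i ∈ Finset.range (N []), quenchedReturn d n (subtree N [i]) s

theorem measurable_prod_children {f : (List ℕ → ℕ) → ℝ → ℝ≥0∞}
    (hf : Measurable fun z : (List ℕ → ℕ) × ℝ => f z.1 z.2) :
    Measurable fun z : (List ℕ → ℕ) × ℝ =>
      ∏ i ∈ Finset.range (z.1 []), f (subtree z.1 [i]) z.2 := by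
  have h : Measurable fun y : ℕ × ((List ℕ → ℕ) × ℝ) =>
      ∏ i ∈ Finset.range y.1, f (subtree y.2.1 [i]) y.2.2 := by
    refine measurable_from_prod_countable_right fun b => ?_
    have hi : ∀ i : ℕ, Measurable fun z : (List ℕ → ℕ) × ℝ => f (subtree z.1 [i]) z.2 := fun i =>
      hf.comp (((measurable_subtree [i]).comp measurable_fst).prodMk measurable_snd)
    exact Finset.measurable_prod (Finset.range b) fun i _ => hi i
  have h0 : Measurable fun z : (List ℕ → ℕ) × ℝ => z.1 [] :=
    (measurable_pi_apply []).comp measurable_fst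
  exact h.comp (h0.prodMk measurable_id)

theorem measurable_edgeMean_children (d : ℝ) {f : (List ℕ → ℕ) → ℝ → ℝ≥0∞}
    (hf : Measurable fun z : (List ℕ → ℕ) × ℝ => f z.1 z.2) :
    Measurable fun z : (List ℕ → ℕ) × ℝ =>
      edgeMean d (fun s => ∏ i ∈ Finset.range (z.1 []), f (subtree z.1 [i]) s) z.2 := by
  have h := measurable_prod_children (f := f) hf
  have h' := measurable_edgeMean (d := d)
    (F := fun N s => ∏ i ∈ Finset.range (N []), f (subtree N [i]) s) h
  exact h'

theorem measurable_quenchedReturn (d : ℝ) (n : ℕ) :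
    Measurable fun z : (List ℕ → ℕ) × ℝ => quenchedReturn d n z.1 z.2 := by
  induction n with
  | zero => exact measurable_const
  | succ n ih =>
    exact measurable_edgeMean_children d ih

theorem lintegral_quenchedReturn (p : PMF ℕ) (d : ℝ) (n : ℕ) (t : ℝ) :
    ∫⁻ N, quenchedReturn d n N t ∂(offspringLaw p) = annealedReturn p d n t := by
  induction n generalizing t with
  | zero => simp [quenchedReturn, annealedReturn]
  | succ n ih =>
    simp only [quenchedReturn, annealedReturn]
    rw [lintegral_edgeMean (offspringLaw p)
      (F := fun N s => ∏ i ∈ Finset.range (N []), quenchedReturn d n (subtree N [i]) s)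
      (measurable_prod_children (f := quenchedReturn d n) (measurable_quenchedReturn d n))]
    congr 1
    funext s
    rw [← ih s]
    exact lintegral_prod_subtrees p (f := fun N => quenchedReturn d n N s)
      ((measurable_quenchedReturn d n).comp (measurable_id.prodMk measurable_const))

theorem quenchedReturn_le_succ (d : ℝ) (n : ℕ) (N : List ℕ → ℕ) (t : ℝ) :
    quenchedReturn d n N t ≤ quenchedReturn d (n + 1) N t := by
  induction n generalizing N t with
  | zero => exact zero_le
  | succ n ih =>
    exact edgeMean_mono (fun s _ => Finset.prod_le_prod' fun i _ => ih (subtree N [i]) s) t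

/-- The quenched probability of no escape through an edge above the root, in terms of the local
time at the upper end of this edge. -/
def edgeReturn (d : ℝ) (N : List ℕ → ℕ) (t : ℝ) : ℝ≥0∞ := ⨆ n, quenchedReturn d n N t

theorem monotone_quenchedReturn (d : ℝ) (N : List ℕ → ℕ) (t : ℝ) :
    Monotone fun n => quenchedReturn d n N t :=
  monotone_nat_of_le_succ fun n => quenchedReturn_le_succ d n N t

theorem prod_iSup_of_monotone {ι : Type*} (s : Finset ι) {f : ι → ℕ → ℝ≥0∞}
    (hf : ∀ i, Monotone (f i)) : ∏ i ∈ s, ⨆ n, f i n = ⨆ n, ∏ i ∈ s, f i n := by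
  classical
  induction s using Finset.induction_on with
  | empty => simp
  | insert a s ha ih =>
    simp only [Finset.prod_insert ha, ih, ENNReal.iSup_mul, ENNReal.mul_iSup]
    refine le_antisymm (iSup_le fun i => iSup_le fun j => ?_) (iSup_le fun n =>
      le_iSup_of_le n (le_iSup_of_le n le_rfl))
    exact le_iSup_of_le (max i j) (mul_le_mul' (hf a (le_max_right i j))
      (Finset.prod_le_prod' fun k _ => hf k (le_max_left i j)))

theorem edgeReturn_eq (d : ℝ) (N : List ℕ → ℕ) (t : ℝ) :
    edgeReturn d N t
      = edgeMean d (fun s => ∏ i ∈ Finset.range (N []), edgeReturn d (subtree N [i]) s) t := by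
  have hprod : ∀ s, ∏ i ∈ Finset.range (N []), edgeReturn d (subtree N [i]) s
      = ⨆ n, ∏ i ∈ Finset.range (N []), quenchedReturn d n (subtree N [i]) s := by
    intro s
    exact prod_iSup_of_monotone _ fun i => monotone_quenchedReturn d _ s
  simp only [hprod]
  rw [edgeMean_iSup]
  · exact (Monotone.iSup_nat_add (monotone_quenchedReturn d N t) 1).symm
  · intro n
    exact (measurable_prod_children (f := quenchedReturn d n) (measurable_quenchedReturn d n)).comp
      (measurable_const.prodMk measurable_id)
  · exact fun m n hmn s => Finset.prod_le_prod' fun i _ => monotone_quenchedReturn d _ s hmn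

theorem lintegral_edgeReturn_le (p : PMF ℕ) (hm : 1 < offspringMean p) (hd : 0 < d) :
    ∫⁻ N, edgeReturn d N 1 ∂(offspringLaw p) < 1 := by
  obtain ⟨c, hc, h⟩ := exists_annealedReturn_le p hm hd
  unfold edgeReturn
  have hmeas : ∀ n, Measurable fun N => quenchedReturn d n N 1 := fun n =>
    (measurable_quenchedReturn d n).comp (measurable_id.prodMk measurable_const)
  rw [lintegral_iSup hmeas fun m n hmn N => monotone_quenchedReturn d N 1 hmn]
  refine (iSup_le fun n => ?_).trans_lt (ENNReal.ofReal_lt_one.2 (by linarith : 1 - c < 1))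
  exact (lintegral_quenchedReturn p d n 1).trans_le (h n)

end Branching

/-! ### The return probability from a vertex of a fixed tree -/

section Quenched
open Set Filter Topology

variable {d : ℝ}

theorem edgeReturn_le_one (hd : 0 < d) (N : List ℕ → ℕ) {t : ℝ} (ht : 0 ≤ t) :
    edgeReturn d N t ≤ 1 := by
  refine iSup_le fun n => ?_
  induction n generalizing N t with
  | zero => exact zero_le
  | succ n ih =>
    have h1 := edgeMean_ofReal hd (IsBddMeas.const 1) (fun _ _ => zero_le_one) ht
    have e : localTimeMean d (fun _ => 1) = fun _ => 1 := funext (localTimeMean_const hd 1)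
    rw [e, relax_const, ENNReal.ofReal_one] at h1
    exact (edgeMean_mono (fun s hs => Finset.prod_le_one' fun i _ => ih _ hs) t).trans_eq h1

/-- The real-valued version of the quenched probability of no escape through the edge above `v`,
extended to a continuous function on the line. -/
def returnCurve (d : ℝ) (N : List ℕ → ℕ) (v : List ℕ) : ℝ → ℝ :=
  relax 1 1 (localTimeMean d fun s =>
    ∏ i ∈ Finset.range (N v), (edgeReturn d (subtree N (i :: v)) s).toReal)

/-- A continuous function with values in `[0, 1]` on the half-line. -/
structure IsProbCurve (F : ℝ → ℝ) : Prop where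
  cont : Continuous F
  nonneg : ∀ t, 0 ≤ t → 0 ≤ F t
  le_one : ∀ t, 0 ≤ t → F t ≤ 1

theorem IsProbCurve.isBddMeas {F : ℝ → ℝ} (hF : IsProbCurve F) : IsBddMeas F :=
  ⟨hF.cont.measurable, 1, fun t ht => abs_le.2 ⟨by linarith [hF.nonneg t ht], hF.le_one t ht⟩⟩

theorem IsProbCurve.mul {F G : ℝ → ℝ} (hF : IsProbCurve F) (hG : IsProbCurve G) :
    IsProbCurve fun t => F t * G t :=
  ⟨hF.cont.mul hG.cont, fun t ht => mul_nonneg (hF.nonneg t ht) (hG.nonneg t ht),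
    fun t ht => mul_le_one₀ (hF.le_one t ht) (hG.nonneg t ht) (hG.le_one t ht)⟩

theorem IsProbCurve.prod {ι : Type*} (s : Finset ι) {F : ι → ℝ → ℝ}
    (hF : ∀ i, IsProbCurve (F i)) : IsProbCurve fun t => ∏ i ∈ s, F i t :=
  ⟨continuous_finsetProd _ fun i _ => (hF i).cont,
    fun t ht => Finset.prod_nonneg fun i _ => (hF i).nonneg t ht,
    fun t ht => Finset.prod_le_one (fun i _ => (hF i).nonneg t ht) fun i _ => (hF i).le_one t ht⟩

theorem isProbCurve_localTimeMean (hd : 0 < d) {F : ℝ → ℝ} (hF : IsBddMeas F)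
    (h0 : ∀ t, 0 ≤ t → 0 ≤ F t) (h1 : ∀ t, 0 ≤ t → F t ≤ 1) :
    IsProbCurve (localTimeMean d F) :=
  ⟨hF.continuous_localTimeMean hd,
    fun t ht => (localTimeMean_const hd 0 t).symm.trans_le
      (localTimeMean_mono hd (IsBddMeas.const 0) hF h0 ht),
    fun t ht => (localTimeMean_mono hd hF (IsBddMeas.const 1) h1 ht).trans_eq
      (localTimeMean_const hd 1 t)⟩

theorem IsProbCurve.localTimeMean (hd : 0 < d) {F : ℝ → ℝ} (hF : IsProbCurve F) :
    IsProbCurve (localTimeMean d F) :=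
  isProbCurve_localTimeMean hd hF.isBddMeas hF.nonneg hF.le_one

theorem IsProbCurve.relax {w : ℝ} (hw : 0 ≤ w) {ω : ℝ → ℝ} (hω : IsProbCurve ω) :
    IsProbCurve (relax w 1 ω) :=
  ⟨continuous_relax w 1 hω.cont,
    fun t ht => (relax_const w 0 t).symm.trans_le
      (relax_mono hw continuous_const hω.cont ht zero_le_one fun s hs _ => hω.nonneg s hs),
    fun t ht => (relax_mono hw hω.cont continuous_const ht le_rfl
      fun s hs _ => hω.le_one s hs).trans_eq (relax_const w 1 t)⟩

theorem measurable_edgeReturn (d : ℝ) (N : List ℕ → ℕ) : Measurable (edgeReturn d N) :=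
  Measurable.iSup fun n =>
    (measurable_quenchedReturn d n).comp (measurable_const.prodMk measurable_id)

theorem isBddMeas_prod_edgeReturn (hd : 0 < d) (N : List ℕ → ℕ) (v : List ℕ) :
    IsBddMeas (fun s => ∏ i ∈ Finset.range (N v), (edgeReturn d (subtree N (i :: v)) s).toReal) ∧
    (∀ s, 0 ≤ s → 0 ≤ ∏ i ∈ Finset.range (N v), (edgeReturn d (subtree N (i :: v)) s).toReal) ∧
    (∀ s, 0 ≤ s → ∏ i ∈ Finset.range (N v), (edgeReturn d (subtree N (i :: v)) s).toReal ≤ 1) := by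
  have h0 : ∀ s, 0 ≤ s →
      0 ≤ ∏ i ∈ Finset.range (N v), (edgeReturn d (subtree N (i :: v)) s).toReal :=
    fun s _ => Finset.prod_nonneg fun i _ => ENNReal.toReal_nonneg
  have h1 : ∀ s, 0 ≤ s →
      ∏ i ∈ Finset.range (N v), (edgeReturn d (subtree N (i :: v)) s).toReal ≤ 1 :=
    fun s hs => Finset.prod_le_one (fun i _ => ENNReal.toReal_nonneg) fun i _ =>
      ENNReal.toReal_le_of_le_ofReal zero_le_one
        ((edgeReturn_le_one hd _ hs).trans_eq ENNReal.ofReal_one.symm)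
  refine ⟨⟨?_, 1, fun s hs => abs_le.2 ⟨by linarith [h0 s hs], h1 s hs⟩⟩, h0, h1⟩
  exact Finset.measurable_prod _ fun i _ => (measurable_edgeReturn d _).ennreal_toReal

theorem isProbCurve_returnCurve (hd : 0 < d) (N : List ℕ → ℕ) (v : List ℕ) :
    IsProbCurve (returnCurve d N v) := by
  obtain ⟨hb, h0, h1⟩ := isBddMeas_prod_edgeReturn hd N v
  exact (isProbCurve_localTimeMean hd hb h0 h1).relax zero_le_one

theorem ofReal_returnCurve (hd : 0 < d) (N : List ℕ → ℕ) (v : List ℕ) {t : ℝ} (ht : 0 ≤ t) :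
    ENNReal.ofReal (returnCurve d N v t) = edgeReturn d (subtree N v) t := by
  obtain ⟨hb, h0, -⟩ := isBddMeas_prod_edgeReturn hd N v
  rw [returnCurve, ← edgeMean_ofReal hd hb h0 ht, edgeReturn_eq]
  have e : subtree N v [] = N v := by simp [subtree]
  simp only [subtree_subtree, e]
  have key : ∀ s, 0 ≤ s → ENNReal.ofReal
      (∏ i ∈ Finset.range (N v), (edgeReturn d (subtree N (i :: v)) s).toReal)
      = ∏ i ∈ Finset.range (N v), edgeReturn d (subtree N (i :: v)) s := fun s hs => by
    rw [ENNReal.ofReal_prod_of_nonneg fun i _ => ENNReal.toReal_nonneg]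
    exact Finset.prod_congr rfl fun i _ => ENNReal.ofReal_toReal
      ((edgeReturn_le_one hd _ hs).trans_lt ENNReal.one_lt_top).ne
  exact le_antisymm (edgeMean_mono (fun s hs => (key s hs).le) t)
    (edgeMean_mono (fun s hs => (key s hs).ge) t)

/-- If the factor `f v` describes the future excursions into the subtree of `v`, then this function
describes the future of the whole subtree of `y`, in terms of the local time left at `y`. -/
def vertexCurve (N : List ℕ → ℕ) (f : List ℕ → ℝ → ℝ) (y : List ℕ) (t : ℝ) : ℝ :=
  ∏ i ∈ Finset.range (N y), f (i :: y) t

theorem returnCurve_eq (hd : 0 < d) (N : List ℕ → ℕ) (v : List ℕ) :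
    returnCurve d N v = relax 1 1 (localTimeMean d (vertexCurve N (returnCurve d N) v)) := by
  conv_lhs => rw [returnCurve]
  congr 1
  funext t
  refine localTimeMean_congr d (fun s hs => Finset.prod_congr rfl fun i _ => ?_) t
  rw [← ofReal_returnCurve hd N _ hs,
    ENNReal.toReal_ofReal ((isProbCurve_returnCurve hd N _).nonneg s hs)]

/-- The probability that the walk returns to the root when it is at the vertex `x`, where `F`
describes the future of the subtree of `x` in terms of the local time left at `x`. This local time
is exponential if `x` is a child of the root; otherwise it is determined by the local time left at
the parent of `x`, and the siblings of `x` contribute their factors `f`. -/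
def pathValue (d : ℝ) (N : List ℕ → ℕ) (f : List ℕ → ℝ → ℝ) : List ℕ → (ℝ → ℝ) → ℝ
  | [], _ => 0
  | [_], F => gammaMean d 0 F
  | i :: j :: u, F => pathValue d N f (j :: u) fun t =>
      (∏ k ∈ (Finset.range (N (j :: u))).erase i, f (k :: j :: u) t) * localTimeMean d F t

section pathValue

variable {N : List ℕ → ℕ} {f : List ℕ → ℝ → ℝ}

theorem pathValue_congr_left {f' : List ℕ → ℝ → ℝ} {x : List ℕ}
    (h : ∀ v, v.length ≤ x.length → f v = f' v) (F : ℝ → ℝ) :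
    pathValue d N f x F = pathValue d N f' x F := by
  induction x generalizing F with
  | nil => rfl
  | cons i u ih =>
    cases u with
    | nil => rfl
    | cons j u =>
      simp only [pathValue]
      rw [ih fun v hv => h v (hv.trans (by simp))]
      congr 1
      funext t
      congr 1
      refine Finset.prod_congr rfl fun k _ => ?_
      rw [h _ (by simp)]

theorem pathValue_congr {x : List ℕ} {F G : ℝ → ℝ} (h : ∀ t, 0 ≤ t → F t = G t) :
    pathValue d N f x F = pathValue d N f x G := by
  induction x generalizing F G with
  | nil => rfl
  | cons i u ih =>
    cases u with
    | nil => exact gammaMean_congr d 0 h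
    | cons j u => exact ih fun t _ => by rw [localTimeMean_congr d h]

theorem pathValue_const_mul (c : ℝ) (x : List ℕ) (F : ℝ → ℝ) :
    pathValue d N f x (fun t => c * F t) = c * pathValue d N f x F := by
  induction x generalizing F with
  | nil => simp [pathValue]
  | cons i u ih =>
    cases u with
    | nil => exact gammaMean_const_mul d 0 c F
    | cons j u =>
      simp only [pathValue, localTimeMean_const_mul, mul_left_comm _ c]
      exact ih _

theorem pathValue_add (hd : 0 < d) (hf : ∀ v, IsProbCurve (f v)) (x : List ℕ) {F G : ℝ → ℝ}
    (hF : IsBddMeas F) (hG : IsBddMeas G) :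
    pathValue d N f x (fun t => F t + G t) = pathValue d N f x F + pathValue d N f x G := by
  induction x generalizing F G with
  | nil => simp [pathValue]
  | cons i u ih =>
    cases u with
    | nil => exact gammaMean_add hd 0 hF hG
    | cons j u =>
      simp only [pathValue, localTimeMean_add hd hF hG, mul_add]
      have hp := (IsProbCurve.prod ((Finset.range (N (j :: u))).erase i)
        fun k => hf (k :: j :: u)).isBddMeas
      exact ih (hp.mul (hF.localTimeMean hd)) (hp.mul (hG.localTimeMean hd))

theorem pathValue_sum (hd : 0 < d) (hf : ∀ v, IsProbCurve (f v)) (x : List ℕ) {ι : Type*}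
    (s : Finset ι) {F : ι → ℝ → ℝ} (hF : ∀ i ∈ s, IsBddMeas (F i)) :
    pathValue d N f x (fun t => ∑ i ∈ s, F i t) = ∑ i ∈ s, pathValue d N f x (F i) := by
  classical
  induction s using Finset.induction_on with
  | empty => simpa using pathValue_const_mul (d := d) (N := N) (f := f) 0 x (fun _ => 0)
  | insert a s ha ih =>
    simp only [Finset.sum_insert ha]
    have h := fun i hi => hF i (Finset.mem_insert_of_mem hi)
    rw [pathValue_add hd hf x (hF a (Finset.mem_insert_self a s)) (IsBddMeas.sum s h), ih h]

theorem pathValue_mem_Icc (hd : 0 < d) (hf : ∀ v, IsProbCurve (f v)) (x : List ℕ) {F : ℝ → ℝ}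
    (hF : IsProbCurve F) : pathValue d N f x F ∈ Icc 0 1 := by
  induction x generalizing F with
  | nil => simp [pathValue]
  | cons i u ih =>
    cases u with
    | nil =>
      exact ⟨(gammaMean_const hd 0 0).symm.trans_le
        (gammaMean_mono hd 0 (IsBddMeas.const 0) hF.isBddMeas hF.nonneg),
        (gammaMean_mono hd 0 hF.isBddMeas (IsBddMeas.const 1) hF.le_one).trans_eq
          (gammaMean_const hd 0 1)⟩
    | cons j u => exact ih ((IsProbCurve.prod _ fun k => hf _).mul (hF.localTimeMean hd))

/-- The probability that the walk returns to the root when it is at the vertex `x`, and the factors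
`f` describe the future excursions into the subtrees off the path from the root to `x`. -/
def returnValue (d : ℝ) (N : List ℕ → ℕ) (f : List ℕ → ℝ → ℝ) (x : List ℕ) : ℝ :=
  pathValue d N f x (vertexCurve N f x)

theorem isProbCurve_vertexCurve (hf : ∀ v, IsProbCurve (f v)) (y : List ℕ) :
    IsProbCurve (vertexCurve N f y) := IsProbCurve.prod _ fun i => hf (i :: y)

theorem hasDerivAt_vertexCurve (hd : 0 < d) (hf : ∀ v, IsProbCurve (f v)) (y : List ℕ) (w : ℕ → ℝ)
    (hc : ∀ j ∈ Finset.range (N y),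
      f (j :: y) = relax (w j) 1 (localTimeMean d (vertexCurve N f (j :: y)))) (t : ℝ) :
    HasDerivAt (vertexCurve N f y)
      (∑ j ∈ Finset.range (N y), w j * ((∏ k ∈ (Finset.range (N y)).erase j, f (k :: y) t) *
        localTimeMean d (vertexCurve N f (j :: y)) t)
        - (∑ j ∈ Finset.range (N y), w j) * vertexCurve N f y t) t := by
  have h := HasDerivAt.fun_finsetProd (u := Finset.range (N y)) (f := fun j => f (j :: y))
    (f' := fun j => w j * (localTimeMean d (vertexCurve N f (j :: y)) t - f (j :: y) t)) (x := t)
    (fun j hj => by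
      have := hasDerivAt_relax (w j) 1
        ((isProbCurve_vertexCurve (N := N) hf (j :: y)).isBddMeas.continuous_localTimeMean hd) t
      rwa [← hc j hj] at this)
  convert! h using 1
  rw [Finset.sum_mul, ← Finset.sum_sub_distrib]
  refine Finset.sum_congr rfl fun j hj => ?_
  rw [vertexCurve, ← Finset.prod_erase_mul _ _ hj, smul_eq_mul]
  ring

/-- The return probability is harmonic for the jumps of the once-reinforced random walk. When the
walk leaves a vertex `y` for its parent, the factor of `y` is replaced by the one of a vertex whose
edge to its parent has weight `d` and whose subtree is in its present state. -/
theorem returnValue_jump (hd : 0 < d) (hf : ∀ v, IsProbCurve (f v)) (hf0 : ∀ v, f v 0 = 1)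
    (i : ℕ) (u : List ℕ) (hi : i < N u) (w : ℕ → ℝ)
    (hc : ∀ j ∈ Finset.range (N (i :: u)),
      f (j :: i :: u) = relax (w j) 1 (localTimeMean d (vertexCurve N f (j :: i :: u)))) :
    (d + ∑ j ∈ Finset.range (N (i :: u)), w j) * returnValue d N f (i :: u)
      = d * (if u = [] then 1 else returnValue d N (Function.update f (i :: u)
          (relax d 1 (localTimeMean d (vertexCurve N f (i :: u))))) u)
        + ∑ j ∈ Finset.range (N (i :: u)), w j * returnValue d N f (j :: i :: u) := by
  have hA := (isProbCurve_vertexCurve (N := N) hf (i :: u)).isBddMeas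
  have hA0 : vertexCurve N f (i :: u) 0 = 1 := Finset.prod_eq_one fun j _ => hf0 _
  have hC : ∀ j ∈ Finset.range (N (i :: u)), IsBddMeas fun t =>
      (∏ k ∈ (Finset.range (N (i :: u))).erase j, f (k :: i :: u) t) *
        localTimeMean d (vertexCurve N f (j :: i :: u)) t := fun j _ =>
    (IsProbCurve.prod _ fun k => hf _).isBddMeas.mul
      ((isProbCurve_vertexCurve hf _).isBddMeas.localTimeMean hd)
  have hder := fun t (_ : (0 : ℝ) ≤ t) => hasDerivAt_vertexCurve hd hf (i :: u) w hc t
  cases u with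
  | nil =>
    have := gammaMean_jump hd _ w hA hC hder
    rw [hA0] at this
    simpa only [if_true, returnValue, pathValue] using this
  | cons i' u =>
    have hjump := localTimeMean_jump hd _ w hA hC hder
    rw [hA0] at hjump
    set y := i :: i' :: u with hy
    set A := vertexCurve N f y
    set P : ℝ → ℝ := fun t => ∏ k ∈ (Finset.range (N (i' :: u))).erase i, f (k :: i' :: u) t
    have hP : IsBddMeas P := (IsProbCurve.prod _ fun k => hf _).isBddMeas
    set χ := relax d 1 (localTimeMean d A) with hχ
    have hχb : IsBddMeas χ :=
      (((isProbCurve_vertexCurve hf y).localTimeMean hd).relax hd.le).isBddMeas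
    have e1 : returnValue d N (Function.update f y χ) (i' :: u)
        = pathValue d N f (i' :: u) fun t => P t * χ t := by
      rw [returnValue, pathValue_congr_left (f' := f)]
      · refine pathValue_congr fun t _ => ?_
        rw [vertexCurve, ← Finset.prod_erase_mul _ _ (Finset.mem_range.2 hi)]
        rw [Function.update_self]
        congr 1
        refine Finset.prod_congr rfl fun k hk => ?_
        rw [Function.update_of_ne]
        simpa [hy] using Finset.ne_of_mem_erase hk
      · intro v hv
        refine Function.update_of_ne (fun h => ?_) _ _
        rw [h, hy] at hv
        simp at hv
    rw [if_neg (by simp), e1]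
    simp only [returnValue, hy, pathValue]
    rw [← pathValue_const_mul, ← pathValue_const_mul]
    simp only [← pathValue_const_mul]
    have hCK := fun j hj => (hC j hj).localTimeMean hd
    rw [← pathValue_sum hd hf _ _ fun j hj => (hP.mul (hCK j hj)).const_mul (w j),
      ← pathValue_add hd hf _ ((hP.mul hχb).const_mul d)
        (IsBddMeas.sum _ fun j hj => (hP.mul (hCK j hj)).const_mul (w j))]
    refine pathValue_congr fun t _ => ?_
    have e2 := congrArg (fun z => P t * z) (hjump t)
    simp only [mul_add, Finset.mul_sum] at e2
    simp only [mul_left_comm _ (P t)] at e2 ⊢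
    linarith

end pathValue

end Quenched

/-! ### The return probability along a trajectory -/

section Walk
open Set Filter Topology

variable {d : ℝ} {N : List ℕ → ℕ} {x x' : ℕ → List ℕ} {k : ℕ}

/-- The edge `{u, v}` is traversed by one of the first `k` jumps of the trajectory `x`. -/
def TraversedBy (x : ℕ → List ℕ) (k : ℕ) (u v : List ℕ) : Prop :=
  ∃ j < k, (x j = u ∧ x (j + 1) = v) ∨ (x j = v ∧ x (j + 1) = u)

theorem traversed_frestrictLe {u v : List ℕ} :
    History.Traversed (k := k) (Preorder.frestrictLe (π := fun _ => List ℕ) k x) u v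
      ↔ TraversedBy x k u v := by
  constructor
  · rintro ⟨j, hj, h⟩
    exact ⟨j, hj, h⟩
  · rintro ⟨j, hj, h⟩
    exact ⟨j, hj, h⟩

theorem traversedBy_comm {u v : List ℕ} : TraversedBy x k u v ↔ TraversedBy x k v u :=
  exists_congr fun _ => and_congr_right fun _ => or_comm

theorem traversedBy_succ {u v : List ℕ} : TraversedBy x (k + 1) u v ↔
    TraversedBy x k u v ∨ (x k = u ∧ x (k + 1) = v) ∨ (x k = v ∧ x (k + 1) = u) := by
  constructor
  · rintro ⟨j, hj, h⟩
    rcases Nat.lt_succ_iff_lt_or_eq.1 hj with hj | rfl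
    · exact .inl ⟨j, hj, h⟩
    · exact .inr h
  · rintro (⟨j, hj, h⟩ | h)
    · exact ⟨j, hj.trans (Nat.lt_succ_self k), h⟩
    · exact ⟨k, Nat.lt_succ_self k, h⟩

/-- The first `k` jumps of the trajectory `x` follow edges of the tree, starting from the root. -/
def IsTreePath (N : List ℕ → ℕ) (x : ℕ → List ℕ) (k : ℕ) : Prop :=
  x 0 = [] ∧ ∀ j < k, (familyTree N).Adj (x j) (x (j + 1))

theorem IsTreePath.of_succ (h : IsTreePath N x (k + 1)) : IsTreePath N x k :=
  ⟨h.1, fun j hj => h.2 j (hj.trans (Nat.lt_succ_self k))⟩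

theorem isTreePath_succ :
    IsTreePath N x (k + 1) ↔ IsTreePath N x k ∧ (familyTree N).Adj (x k) (x (k + 1)) := by
  refine ⟨fun h => ⟨h.of_succ, h.2 k (Nat.lt_succ_self k)⟩, fun h => ⟨h.1.1, fun j hj => ?_⟩⟩
  rcases Nat.lt_succ_iff_lt_or_eq.1 hj with hj | rfl
  · exact h.1.2 j hj
  · exact h.2

theorem IsTreePath.isBorn (h : IsTreePath N x k) : IsBorn N (x k) := by
  cases k with
  | zero => rw [h.1]; trivial
  | succ k => exact (h.2 k (Nat.lt_succ_self k)).2.1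

/-- The factors of the vertices after `k` jumps of the trajectory `x`: the factor of a vertex
changes whenever the walk leaves this vertex for its parent. -/
def factors (d : ℝ) (N : List ℕ → ℕ) (x : ℕ → List ℕ) : ℕ → List ℕ → ℝ → ℝ
  | 0 => returnCurve d N
  | k + 1 =>
    if x (k + 1) = (x k).tail then
      Function.update (factors d N x k) (x k)
        (relax d 1 (localTimeMean d (vertexCurve N (factors d N x k) (x k))))
    else factors d N x k

open Classical in
/-- The current weight of the edge from `v` to its parent. -/
def parentWeight (d : ℝ) (x : ℕ → List ℕ) (k : ℕ) (v : List ℕ) : ℝ :=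
  if TraversedBy x k v v.tail then d else 1

theorem factors_spec (hd : 0 < d) (N : List ℕ → ℕ) (x : ℕ → List ℕ) (k : ℕ) :
    (∀ v, IsProbCurve (factors d N x k v)) ∧ ∀ v, factors d N x k v 0 = 1 := by
  induction k with
  | zero =>
    refine ⟨isProbCurve_returnCurve hd N, fun v => ?_⟩
    rw [factors, returnCurve, relax_zero]
  | succ k ih =>
    rw [factors]
    split_ifs
    · refine ⟨fun v => ?_, fun v => ?_⟩
      · rcases eq_or_ne v (x k) with rfl | hv
        · rw [Function.update_self]
          exact ((isProbCurve_vertexCurve ih.1 _).localTimeMean hd).relax hd.le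
        · rw [Function.update_of_ne hv]
          exact ih.1 v
      · rcases eq_or_ne v (x k) with rfl | hv
        · rw [Function.update_self, relax_zero]
        · rw [Function.update_of_ne hv]
          exact ih.2 v
    · exact ih

theorem not_suffix_cons_iff {v u : List ℕ} {i : ℕ} :
    ¬ v <:+ i :: u ↔ v ≠ i :: u ∧ ¬ v <:+ u := by
  rw [List.suffix_cons_iff, not_or]

theorem IsTreePath.traversedBy_of_suffix (h : IsTreePath N x k) {v : List ℕ} (hv : v ≠ [])
    (hs : v <:+ x k) : TraversedBy x k v v.tail := by
  induction k with
  | zero =>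
    rw [h.1] at hs
    exact absurd (List.suffix_nil.1 hs) hv
  | succ k ih =>
    rw [traversedBy_succ]
    obtain ⟨-, -, ⟨i, hi⟩ | ⟨i, hi⟩⟩ := h.2 k (Nat.lt_succ_self k)
    · rw [hi, List.suffix_cons_iff] at hs
      rcases hs with rfl | hs
      · exact .inr (.inr ⟨rfl, hi⟩)
      · exact .inl (ih h.of_succ hs)
    · refine .inl (ih h.of_succ ?_)
      rw [hi]
      exact hs.trans (List.suffix_cons i _)

/-- Off the path from the root to the present position, the factors obey the equation that
corresponds to the current weights. -/
theorem IsTreePath.factors_eq (hd : 0 < d) (h : IsTreePath N x k) {v : List ℕ}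
    (hs : ¬ v <:+ x k) : factors d N x k v
      = relax (parentWeight d x k v) 1 (localTimeMean d (vertexCurve N (factors d N x k) v)) := by
  induction k generalizing v with
  | zero =>
    have : parentWeight d x 0 v = 1 := if_neg fun ⟨j, hj, _⟩ => absurd hj (Nat.not_lt_zero j)
    rw [this]
    exact returnCurve_eq hd N v
  | succ k ih =>
    have hne : v ≠ [] := fun h0 => hs (h0 ▸ List.nil_suffix)
    obtain ⟨-, -, ⟨i, hi⟩ | ⟨i, hi⟩⟩ := h.2 k (Nat.lt_succ_self k)
    · -- a jump away from the root
      rw [hi, not_suffix_cons_iff] at hs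
      have hlen : x (k + 1) ≠ (x k).tail := fun h0 => by
        have := congrArg List.length (hi.symm.trans h0)
        simp at this
        omega
      have hw : parentWeight d x (k + 1) v = parentWeight d x k v := by
        unfold parentWeight
        congr 1
        rw [traversedBy_succ, eq_iff_iff, or_iff_left]
        rintro (⟨h1, h2⟩ | ⟨h1, h2⟩)
        · have := congrArg List.length (hi.symm.trans h2)
          rw [← h1] at this
          simp at this
          omega
        · exact hs.1 (h2.symm.trans hi)
      rw [factors, if_neg hlen, hw]
      exact ih h.of_succ hs.2
    · -- a jump towards the root
      have htail : x (k + 1) = (x k).tail := by rw [hi]; rfl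
      rw [factors, if_pos htail]
      have hcurve : ∀ w, ¬ w <:+ x (k + 1) → vertexCurve N (Function.update (factors d N x k) (x k)
          (relax d 1 (localTimeMean d (vertexCurve N (factors d N x k) (x k))))) w
          = vertexCurve N (factors d N x k) w := by
        intro w hw
        funext t
        refine Finset.prod_congr rfl fun j _ => ?_
        rw [Function.update_of_ne]
        intro h0
        rw [hi, List.cons.injEq] at h0
        exact hw (h0.2 ▸ List.suffix_rfl)
      rw [hcurve v hs]
      rcases eq_or_ne v (x k) with rfl | hv
      · have hw : parentWeight d x (k + 1) (x k) = d := if_pos (by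
          rw [traversedBy_succ]
          exact .inr (.inl ⟨rfl, htail⟩))
        rw [Function.update_self, hw]
      · have hw : parentWeight d x (k + 1) v = parentWeight d x k v := by
          unfold parentWeight
          congr 1
          rw [traversedBy_succ, eq_iff_iff, or_iff_left]
          rintro (⟨h1, h2⟩ | ⟨h1, h2⟩)
          · exact hv h1.symm
          · exact hs (h2 ▸ List.suffix_rfl)
        rw [Function.update_of_ne hv, hw]
        refine ih h.of_succ ?_
        rw [hi, not_suffix_cons_iff]
        exact ⟨fun h0 => hv (h0.trans hi.symm), hs⟩

open Classical in
/-- The conditional probability, after `k ≥ 1` jumps of the trajectory `x`, that the walk returns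
to the root; trajectories that have returned to the root, or that do not follow the edges of the
tree, count as returned. -/
def returnPotential (d : ℝ) (N : List ℕ → ℕ) (k : ℕ) (x : ℕ → List ℕ) : ℝ≥0∞ :=
  if IsTreePath N x k ∧ ∀ j, 1 ≤ j → j ≤ k → x j ≠ [] then
    ENNReal.ofReal (returnValue d N (factors d N x k) (x k)) else 1

theorem returnPotential_le_one (hd : 0 < d) : returnPotential d N k x ≤ 1 := by
  unfold returnPotential
  split_ifs
  · have hf := (factors_spec hd N x k).1
    exact ENNReal.ofReal_le_one.2 (pathValue_mem_Icc hd hf _ (isProbCurve_vertexCurve hf _)).2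
  · exact le_rfl

theorem isTreePath_congr (h : ∀ j ≤ k, x j = x' j) : IsTreePath N x k ↔ IsTreePath N x' k := by
  unfold IsTreePath
  rw [h 0 (Nat.zero_le k)]
  refine and_congr_right fun _ => forall₂_congr fun j hj => ?_
  rw [h j hj.le, h (j + 1) hj]

theorem factors_congr (h : ∀ j ≤ k, x j = x' j) : factors d N x k = factors d N x' k := by
  induction k with
  | zero => rfl
  | succ k ih =>
    have := ih fun j hj => h j (hj.trans (Nat.le_succ k))
    rw [factors, factors, this, h k (Nat.le_succ k), h (k + 1) le_rfl]

theorem returnPotential_congr (h : ∀ j ≤ k, x j = x' j) :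
    returnPotential d N k x = returnPotential d N k x' := by
  unfold returnPotential
  rw [factors_congr h, h k le_rfl]
  congr 1
  rw [eq_iff_iff, isTreePath_congr h]
  refine and_congr_right fun _ => forall_congr' fun j => forall₂_congr fun _ hj => ?_
  rw [h j hj]

theorem measurable_of_dependsOn_Iic {V : Type*} [MeasurableSpace V] [Countable V]
    [DiscreteMeasurableSpace V] [Nonempty V] {f : (ℕ → V) → ℝ≥0∞} {k : ℕ}
    (hf : DependsOn f (Finset.Iic k : Set ℕ)) : Measurable f := by
  obtain ⟨g, rfl⟩ := (dependsOn_iff_exists_comp).1 hf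
  have hg : Measurable g := by
    have : Countable ((i : (Finset.Iic k : Set ℕ)) → V) := by
      have : Finite (Finset.Iic k : Set ℕ) := (Finset.Iic k).finite_toSet
      infer_instance
    exact measurable_of_countable g
  exact hg.comp (by fun_prop)

theorem dependsOn_returnPotential (d : ℝ) (N : List ℕ → ℕ) (k : ℕ) :
    DependsOn (returnPotential d N k) (Finset.Iic k : Set ℕ) := fun _ _ h =>
  returnPotential_congr fun j hj => h j (by simpa using hj)

theorem measurable_returnPotential (d : ℝ) (N : List ℕ → ℕ) (k : ℕ) :
    Measurable (returnPotential d N k) :=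
  measurable_of_dependsOn_Iic (dependsOn_returnPotential d N k)

end Walk

/-! ### The supermartingale, and transience -/

section Transience
open Set Filter Topology

variable {d : ℝ} {N : List ℕ → ℕ} {x : ℕ → List ℕ} {k : ℕ}

open Classical in
/-- The sum over the neighbours of a vertex splits into the parent, across an edge of weight `d`,
and the children. -/
theorem tsum_edgeWeight_mul (h : History (List ℕ) k) {i : ℕ} {u : List ℕ} (hb : IsBorn N (i :: u))
    (ht : h.Traversed (i :: u) u) (g : List ℕ → ℝ≥0∞) :
    ∑' v, edgeWeight d (familyTree N) h (i :: u) v * g v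
      = ENNReal.ofReal d * g u + ∑ j ∈ Finset.range (N (i :: u)),
        (if h.Traversed (i :: u) (j :: i :: u) then ENNReal.ofReal d else 1) * g (j :: i :: u) := by
  have hinj : Function.Injective fun j : ℕ => j :: i :: u := fun a b hab => by simpa using hab
  have hu : u ∉ (Finset.range (N (i :: u))).image fun j => j :: i :: u := by
    rw [Finset.mem_image]
    rintro ⟨j, -, hj⟩
    have := congrArg List.length hj
    simp at this
    omega
  rw [tsum_eq_sum (s := insert u ((Finset.range (N (i :: u))).image fun j => j :: i :: u)),
    Finset.sum_insert hu, Finset.sum_image hinj.injOn]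
  · congr 1
    · rw [edgeWeight, if_pos, if_pos ht]
      exact ⟨hb, hb.1, .inr ⟨i, rfl⟩⟩
    · refine Finset.sum_congr rfl fun j hj => ?_
      rw [edgeWeight, if_pos]
      exact ⟨hb, ⟨hb, Finset.mem_range.1 hj⟩, .inl ⟨j, rfl⟩⟩
  · intro v hv
    rw [edgeWeight, if_neg, zero_mul]
    rintro ⟨-, hv1, ⟨j, rfl⟩ | ⟨j, hj⟩⟩
    · exact hv (Finset.mem_insert_of_mem
        (Finset.mem_image_of_mem (fun j => j :: i :: u) (Finset.mem_range.2 hv1.2)))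
    · rw [List.cons.injEq] at hj
      exact hv (hj.2 ▸ Finset.mem_insert_self _ _)

theorem tsum_orrwStep_mul (G : SimpleGraph (List ℕ)) (h : History (List ℕ) k)
    (h0 : ∑' v, edgeWeight d G h (h.pos k le_rfl) v ≠ 0)
    (h1 : ∑' v, edgeWeight d G h (h.pos k le_rfl) v ≠ ∞) (g : List ℕ → ℝ≥0∞) :
    ∑' v, orrwStep d G k h v * g v = (∑' v, edgeWeight d G h (h.pos k le_rfl) v)⁻¹ *
      ∑' v, edgeWeight d G h (h.pos k le_rfl) v * g v := by
  rw [← ENNReal.tsum_mul_left]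
  refine tsum_congr fun v => ?_
  rw [orrwStep, dif_pos ⟨h0, h1⟩, PMF.normalize_apply]
  ring

/-- The return probability is a supermartingale along the walk. -/
theorem tsum_orrwStep_mul_returnPotential_le (hd : 0 < d) (hk : 1 ≤ k) :
    ∑' v, orrwStep d (familyTree N) k (Preorder.frestrictLe (π := fun _ => List ℕ) k x) v *
      returnPotential d N (k + 1) (Function.update x (k + 1) v) ≤ returnPotential d N k x := by
  classical
  set h : History (List ℕ) k := Preorder.frestrictLe (π := fun _ => List ℕ) k x with hh
  by_cases hgood : IsTreePath N x k ∧ ∀ j, 1 ≤ j → j ≤ k → x j ≠ []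
  swap
  · rw [returnPotential, if_neg hgood]
    calc _ ≤ ∑' v, orrwStep d (familyTree N) k h v :=
          ENNReal.tsum_le_tsum fun v => mul_le_of_le_one_right' (returnPotential_le_one hd)
      _ = 1 := PMF.tsum_coe _
  obtain ⟨hpath, hret⟩ := hgood
  obtain ⟨i, u, hiu⟩ := List.exists_cons_of_ne_nil (hret k hk le_rfl)
  have hpos : h.pos k le_rfl = i :: u := hiu
  have hb : IsBorn N (i :: u) := hiu ▸ hpath.isBorn
  have htrav : h.Traversed (i :: u) u := by
    rw [hh, traversed_frestrictLe]
    exact hpath.traversedBy_of_suffix (by simp) (hiu ▸ List.suffix_rfl)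
  set f := factors d N x k with hf
  obtain ⟨hf1, hf0⟩ := factors_spec hd N x k
  set w : ℕ → ℝ := fun j => parentWeight d x k (j :: i :: u) with hw
  have hw0 : ∀ j, 0 ≤ w j := fun j => by
    simp only [hw, parentWeight]
    split_ifs <;> positivity
  have hwe : ∀ j, (if h.Traversed (i :: u) (j :: i :: u) then ENNReal.ofReal d else 1)
      = ENNReal.ofReal (w j) := fun j => by
    have hiff : h.Traversed (i :: u) (j :: i :: u) ↔
        TraversedBy x k (j :: i :: u) (j :: i :: u).tail := by
      rw [hh, traversed_frestrictLe]
      exact traversedBy_comm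
    by_cases ht : h.Traversed (i :: u) (j :: i :: u)
    · rw [if_pos ht]
      exact congrArg ENNReal.ofReal (if_pos (hiff.1 ht)).symm
    · rw [if_neg ht, ← ENNReal.ofReal_one]
      exact congrArg ENNReal.ofReal (if_neg (mt hiff.2 ht)).symm
  have hsum := tsum_edgeWeight_mul (d := d) h hb htrav
  simp only [hwe] at hsum
  have hW : ∑' v, edgeWeight d (familyTree N) h (h.pos k le_rfl) v
      = ENNReal.ofReal (d + ∑ j ∈ Finset.range (N (i :: u)), w j) := by
    have := hsum 1
    simp only [Pi.one_apply, mul_one] at this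
    rw [hpos, this, ENNReal.ofReal_add hd.le (Finset.sum_nonneg fun j _ => hw0 j),
      ENNReal.ofReal_sum_of_nonneg fun j _ => hw0 j]
  have hWpos : 0 < d + ∑ j ∈ Finset.range (N (i :: u)), w j :=
    add_pos_of_pos_of_nonneg hd (Finset.sum_nonneg fun j _ => hw0 j)
  have hcongr : ∀ v, ∀ j ≤ k, Function.update x (k + 1) v j = x j := fun v j hj =>
    Function.update_of_ne (by omega) _ _
  have hpath' : ∀ v, (familyTree N).Adj (i :: u) v →
      IsTreePath N (Function.update x (k + 1) v) (k + 1) := fun v hv => by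
    rw [isTreePath_succ, isTreePath_congr (hcongr v), hcongr v k le_rfl, hiu,
      Function.update_self]
    exact ⟨hpath, hv⟩
  have hret' : ∀ v, v ≠ [] → ∀ j, 1 ≤ j → j ≤ k + 1 → Function.update x (k + 1) v j ≠ [] := by
    intro v hv j hj1 hj2
    rcases eq_or_ne j (k + 1) with rfl | hj
    · rwa [Function.update_self]
    · rw [hcongr v j (by omega)]
      exact hret j hj1 (by omega)
  -- the value after a jump to the parent
  have hup : returnPotential d N (k + 1) (Function.update x (k + 1) u)
      = ENNReal.ofReal (if u = [] then 1 else returnValue d N (Function.update f (i :: u)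
          (relax d 1 (localTimeMean d (vertexCurve N f (i :: u))))) u) := by
    rcases eq_or_ne u [] with rfl | hu
    · rw [returnPotential, if_neg, if_pos rfl, ENNReal.ofReal_one]
      rintro ⟨-, h2⟩
      exact h2 (k + 1) (by omega) le_rfl (Function.update_self _ _ _)
    · rw [returnPotential, if_pos ⟨hpath' u ⟨hb, hb.1, .inr ⟨i, rfl⟩⟩, hret' u hu⟩, if_neg hu,
        factors, factors_congr (hcongr u), hcongr u k le_rfl, hiu, Function.update_self,
        if_pos (show u = (i :: u).tail from rfl)]
  -- the value after a jump to a child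
  have hdown : ∀ j ∈ Finset.range (N (i :: u)),
      returnPotential d N (k + 1) (Function.update x (k + 1) (j :: i :: u))
        = ENNReal.ofReal (returnValue d N f (j :: i :: u)) := by
    intro j hj
    have hne : j :: i :: u ≠ u := fun h0 => by
      have := congrArg List.length h0
      simp at this
      omega
    rw [returnPotential, if_pos ⟨hpath' _ ⟨hb, ⟨hb, Finset.mem_range.1 hj⟩, .inl ⟨j, rfl⟩⟩,
      hret' _ (by simp)⟩, factors, factors_congr (hcongr _), hcongr _ k le_rfl, hiu,
      Function.update_self, if_neg (by simpa using hne)]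
  have hV0 : ∀ v, 0 ≤ returnValue d N f v := fun v =>
    (pathValue_mem_Icc hd hf1 _ (isProbCurve_vertexCurve hf1 _)).1
  have hjump := returnValue_jump hd hf1 hf0 i u hb.2 w fun j _ => by
    refine hpath.factors_eq hd fun hs => ?_
    have := hs.length_le
    rw [hiu] at this
    simp at this
  have hchildren : ∑ j ∈ Finset.range (N (i :: u)), ENNReal.ofReal (w j) *
        returnPotential d N (k + 1) (Function.update x (k + 1) (j :: i :: u))
      = ∑ j ∈ Finset.range (N (i :: u)),
        ENNReal.ofReal (w j) * ENNReal.ofReal (returnValue d N f (j :: i :: u)) :=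
    Finset.sum_congr rfl fun j hj => by rw [hdown j hj]
  have hR : returnPotential d N k x = ENNReal.ofReal (returnValue d N f (i :: u)) := by
    rw [returnPotential, if_pos ⟨hpath, hret⟩, hiu]
  rw [tsum_orrwStep_mul _ _ (by rw [hW]; simpa using hWpos)
    (by rw [hW]; exact ENNReal.ofReal_ne_top), hW, hpos, hsum, hup, hchildren, hR]
  have hup0 : (0 : ℝ) ≤ if u = [] then 1 else returnValue d N (Function.update f (i :: u)
          (relax d 1 (localTimeMean d (vertexCurve N f (i :: u))))) u := by
    split_ifs
    · exact zero_le_one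
    · have hf' : ∀ v, IsProbCurve (Function.update f (i :: u)
          (relax d 1 (localTimeMean d (vertexCurve N f (i :: u)))) v) := fun v => by
        rcases eq_or_ne v (i :: u) with rfl | hv
        · rw [Function.update_self]
          exact ((isProbCurve_vertexCurve hf1 _).localTimeMean hd).relax hd.le
        · rw [Function.update_of_ne hv]
          exact hf1 v
      exact (pathValue_mem_Icc hd hf' _ (isProbCurve_vertexCurve hf' _)).1
  have e : ENNReal.ofReal d * ENNReal.ofReal (if u = [] then 1 else returnValue d N
        (Function.update f (i :: u)
          (relax d 1 (localTimeMean d (vertexCurve N f (i :: u))))) u)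
      + ∑ j ∈ Finset.range (N (i :: u)),
        ENNReal.ofReal (w j) * ENNReal.ofReal (returnValue d N f (j :: i :: u))
      = ENNReal.ofReal (d + ∑ j ∈ Finset.range (N (i :: u)), w j) *
        ENNReal.ofReal (returnValue d N f (i :: u)) := by
    rw [← ENNReal.ofReal_mul hWpos.le, hjump, ENNReal.ofReal_add (mul_nonneg hd.le hup0)
      (Finset.sum_nonneg fun j _ => mul_nonneg (hw0 j) (hV0 _)), ENNReal.ofReal_mul hd.le,
      ENNReal.ofReal_sum_of_nonneg fun j _ => mul_nonneg (hw0 j) (hV0 _)]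
    congr 1
    exact Finset.sum_congr rfl fun j _ => (ENNReal.ofReal_mul (hw0 j)).symm
  rw [e, ← mul_assoc, ENNReal.inv_mul_cancel (by simpa using hWpos) ENNReal.ofReal_ne_top, one_mul]

theorem lmarginalPartialTraj_orrwKernel_succ (G : SimpleGraph (List ℕ)) (k : ℕ)
    {f : (ℕ → List ℕ) → ℝ≥0∞} (hf : Measurable f) (x : ℕ → List ℕ) :
    Kernel.lmarginalPartialTraj (X := fun _ => List ℕ) (orrwKernel d G) k (k + 1) f x
      = ∑' v, orrwStep d G k (Preorder.frestrictLe (π := fun _ => List ℕ) k x) v *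
        f (Function.update x (k + 1) v) := by
  rw [Kernel.lmarginalPartialTraj_succ (X := fun _ => List ℕ) k hf, lintegral_countable']
  refine tsum_congr fun v => ?_
  rw [mul_comm]
  congr 1
  exact PMF.toMeasure_apply_singleton _ _ (measurableSet_singleton v)

theorem lintegral_orrwLaw_of_dependsOn (G : SimpleGraph (List ℕ)) (n : ℕ)
    {f : (ℕ → List ℕ) → ℝ≥0∞} (hf : DependsOn f (Finset.Iic n : Set ℕ)) (ρ : List ℕ) :
    ∫⁻ x, f x ∂(orrwLaw d G ρ) = Kernel.lmarginalPartialTraj (X := fun _ => List ℕ)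
      (orrwKernel d G) 0 n f (fun _ => ρ) := by
  have hm := measurable_of_dependsOn_Iic hf
  rw [Kernel.lmarginalPartialTraj, ← Kernel.traj_map_frestrictLe_apply,
    lintegral_map (by fun_prop) (by fun_prop)]
  refine lintegral_congr fun x => hf fun j hj => ?_
  simp only [Function.updateFinset, Preorder.frestrictLe_apply]
  rw [dif_pos (by simpa using hj)]

theorem lintegral_returnPotential_le (hd : 0 < d) (n : ℕ) :
    ∫⁻ x, returnPotential d N (n + 1) x ∂(orrwLaw d (familyTree N) [])
      ≤ ∑' v, orrwStep d (familyTree N) 0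
          (Preorder.frestrictLe (π := fun _ => List ℕ) 0 fun _ => []) v *
        returnPotential d N 1 (Function.update (fun _ => []) 1 v) := by
  rw [lintegral_orrwLaw_of_dependsOn _ _ (dependsOn_returnPotential d N (n + 1)),
    ← lmarginalPartialTraj_orrwKernel_succ _ 0 (measurable_returnPotential d N 1)]
  induction n with
  | zero => exact le_rfl
  | succ n ih =>
    rw [← Kernel.lmarginalPartialTraj_self (X := fun _ => List ℕ) (Nat.zero_le (n + 1))
      (Nat.le_succ (n + 1)) (measurable_returnPotential d N (n + 1 + 1))]
    refine (Kernel.lmarginalPartialTraj_mono (X := fun _ => List ℕ) _ _ (fun x => ?_) _).trans ih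
    rw [lmarginalPartialTraj_orrwKernel_succ _ _ (measurable_returnPotential d N _)]
    exact tsum_orrwStep_mul_returnPotential_le hd (by omega)

/-- The probability of a return is at most the mean of the supermartingale after the first jump. -/
theorem orrwLaw_return_le (hd : 0 < d) :
    orrwLaw d (familyTree N) [] {x | ∃ k, 1 ≤ k ∧ x k = x 0}
      ≤ ∑' v, orrwStep d (familyTree N) 0
          (Preorder.frestrictLe (π := fun _ => List ℕ) 0 fun _ => []) v *
        returnPotential d N 1 (Function.update (fun _ => []) 1 v) := by
  have hU : {x : ℕ → List ℕ | ∃ k, 1 ≤ k ∧ x k = x 0}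
      = ⋃ n : ℕ, {x | ∃ k, 1 ≤ k ∧ k ≤ n + 1 ∧ x k = x 0} := by
    ext x
    simp only [mem_ofPred_eq, mem_iUnion]
    exact ⟨fun ⟨k, h1, h2⟩ => ⟨k, k, h1, by omega, h2⟩, fun ⟨_, k, h1, _, h2⟩ => ⟨k, h1, h2⟩⟩
  have hmono : Monotone fun n : ℕ => {x : ℕ → List ℕ | ∃ k, 1 ≤ k ∧ k ≤ n + 1 ∧ x k = x 0} :=
    fun m n hmn x ⟨k, h1, h2, h3⟩ => ⟨k, h1, h2.trans (by omega), h3⟩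
  rw [hU, hmono.measure_iUnion]
  refine iSup_le fun n => le_trans ?_ (lintegral_returnPotential_le hd n)
  refine le_trans ?_ (mul_meas_ge_le_lintegral (measurable_returnPotential d N (n + 1)) 1)
  rw [one_mul]
  refine measure_mono fun x hx => ?_
  obtain ⟨k, h1, h2, h3⟩ := hx
  rw [mem_ofPred_eq, returnPotential, if_neg]
  rintro ⟨h4, h5⟩
  exact h5 k h1 h2 (h3.trans h4.1)

/-- If the walk returned almost surely from every child of the root, all factors of these children
would be `1`, since exponential laws charge every subinterval of the half-line; then so would be the
return probability through an edge above the root. -/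
theorem exists_returnValue_lt_one (hd : 0 < d) (hN : edgeReturn d N 1 < 1) :
    ∃ i < N [], returnValue d N (returnCurve d N) [i] < 1 := by
  by_contra! hcon
  have hp := isProbCurve_returnCurve hd N
  have hchild : ∀ i ∈ Finset.range (N []), returnCurve d N [i] = fun _ => 1 := by
    intro i hi
    have hF := isProbCurve_vertexCurve (N := N) hp [i]
    have hge : 1 ≤ gammaMean d 0 (vertexCurve N (returnCurve d N) [i]) :=
      hcon i (Finset.mem_range.1 hi)
    set F := vertexCurve N (returnCurve d N) [i] with hFdef
    have hb : IsBddMeas fun s => 1 - F s := (IsBddMeas.const 1).sub hF.isBddMeas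
    have hnn : ∀ s ∈ Ioi (0 : ℝ), 0 ≤ gammaDensity d 0 s * (1 - F s) := fun s hs =>
      mul_nonneg (gammaDensity_nonneg hd 0 (le_of_lt hs))
        (sub_nonneg.2 (hF.le_one s (le_of_lt hs)))
    have hzero : ∫ s in Ioi 0, gammaDensity d 0 s * (1 - F s) = 0 := by
      refine le_antisymm ?_ (setIntegral_nonneg measurableSet_Ioi hnn)
      have := gammaMean_sub hd 0 (IsBddMeas.const 1) hF.isBddMeas
      rw [gammaMean_const hd] at this
      exact this.trans_le (by linarith)
    rw [setIntegral_eq_zero_iff_of_nonneg_ae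
      ((ae_restrict_mem measurableSet_Ioi).mono hnn) (hb.integrableOn_gamma hd 0)] at hzero
    have hae : ∀ᵐ s ∂(volume.restrict (Ioi (0 : ℝ))), F s = 1 := by
      filter_upwards [hzero, ae_restrict_mem measurableSet_Ioi] with s hs hs0
      have hpos : gammaDensity d 0 s ≠ 0 := by
        have : 0 < s := hs0
        unfold gammaDensity
        positivity
      have := (mul_eq_zero.1 hs).resolve_left hpos
      linarith
    have hgam : ∀ k, gammaMean d k F = 1 := fun k => by
      rw [← gammaMean_const hd k 1]
      exact integral_congr_ae (hae.mono fun s hs => by simp only [hs])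
    have hK : localTimeMean d F = fun _ => 1 := funext fun t => by
      simp only [localTimeMean, hgam, poissonMean_const]
    rw [returnCurve_eq hd, ← hFdef, hK]
    exact funext fun t => relax_const 1 1 t
  have hroot : vertexCurve N (returnCurve d N) [] = fun _ => 1 := funext fun t =>
    Finset.prod_eq_one fun i hi => by rw [hchild i hi]
  have h1 := ofReal_returnCurve hd N [] zero_le_one
  rw [returnCurve_eq hd, hroot, funext (localTimeMean_const hd 1), relax_const,
    ENNReal.ofReal_one] at h1
  have e : subtree N [] = N := funext fun u => by simp [subtree]
  rw [e] at h1
  exact hN.ne h1.symm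

open Classical in
theorem orrwLaw_return_lt_one (hd : 0 < d) (hN : edgeReturn d N 1 < 1) :
    orrwLaw d (familyTree N) [] {x | ∃ k, 1 ≤ k ∧ x k = x 0} < 1 := by
  obtain ⟨i, hi, hV⟩ := exists_returnValue_lt_one hd hN
  refine (orrwLaw_return_le hd).trans_lt ?_
  set h : History (List ℕ) 0 := Preorder.frestrictLe (π := fun _ => List ℕ) 0 fun _ => [] with hh
  have hadj : ∀ v, (familyTree N).Adj [] v ↔ v ∈ (Finset.range (N [])).image fun j => [j] := by
    intro v
    rw [Finset.mem_image]
    constructor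
    · rintro ⟨-, hv, ⟨j, rfl⟩ | ⟨j, hj⟩⟩
      · exact ⟨j, Finset.mem_range.2 hv.2, rfl⟩
      · simp at hj
    · rintro ⟨j, hj, rfl⟩
      exact ⟨trivial, ⟨trivial, Finset.mem_range.1 hj⟩, .inl ⟨j, rfl⟩⟩
  have hweight : ∀ v, edgeWeight d (familyTree N) h [] v
      = if (familyTree N).Adj [] v then 1 else 0 := fun v => by
    rw [edgeWeight]
    congr 1
    exact if_neg fun ⟨j, hj, _⟩ => absurd hj (Nat.not_lt_zero j)
  have hmem : [i] ∈ (Finset.range (N [])).image fun j => [j] :=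
    Finset.mem_image_of_mem (fun j => [j]) (Finset.mem_range.2 hi)
  have hpos : h.pos 0 le_rfl = [] := rfl
  have hw1 : edgeWeight d (familyTree N) h [] [i] = 1 := by rw [hweight, if_pos ((hadj _).2 hmem)]
  have h0 : ∑' v, edgeWeight d (familyTree N) h (h.pos 0 le_rfl) v ≠ 0 := by
    rw [hpos]
    intro hz
    have := ENNReal.tsum_eq_zero.1 hz [i]
    rw [hw1] at this
    exact one_ne_zero this
  have htop : ∑' v, edgeWeight d (familyTree N) h (h.pos 0 le_rfl) v ≠ ∞ := by
    rw [hpos, tsum_eq_sum (s := (Finset.range (N [])).image fun j => [j]) fun v hv => by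
      rw [hweight, if_neg (mt (hadj v).1 hv)]]
    refine ENNReal.sum_ne_top.2 fun v _ => ?_
    rw [hweight]
    split_ifs <;> simp
  have hstep : orrwStep d (familyTree N) 0 h [i] ≠ 0 := by
    rw [orrwStep, dif_pos ⟨h0, htop⟩, PMF.normalize_apply, hpos, hw1, one_mul]
    exact ENNReal.inv_ne_zero.2 (hpos ▸ htop)
  have hpot : returnPotential d N 1 (Function.update (fun _ => []) 1 [i]) < 1 := by
    have hfac : factors d N (Function.update (fun _ => []) 1 [i]) 1 = returnCurve d N := by
      rw [factors, if_neg (by simp), factors]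
    rw [returnPotential, if_pos, hfac, Function.update_self, ENNReal.ofReal_lt_one]
    · exact hV
    · refine ⟨⟨rfl, fun j hj => ?_⟩, fun j h1 h2 => ?_⟩
      · obtain rfl : j = 0 := by omega
        rw [zero_add, Function.update_self]
        exact (hadj _).2 hmem
      · obtain rfl : j = 1 := by omega
        simp
  calc _ < ∑' v, orrwStep d (familyTree N) 0 h v := by
        refine ENNReal.tsum_lt_tsum (i := [i]) ?_
          (fun v => mul_le_of_le_one_right' (returnPotential_le_one hd)) ?_
        · refine ne_top_of_le_ne_top ENNReal.one_ne_top ?_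
          rw [← (orrwStep d (familyTree N) 0 h).tsum_coe]
          exact ENNReal.tsum_le_tsum fun v => mul_le_of_le_one_right' (returnPotential_le_one hd)
        · calc _ < orrwStep d (familyTree N) 0 h [i] * 1 :=
                (ENNReal.mul_lt_mul_iff_right hstep (PMF.apply_ne_top _ _)).2 hpot
            _ = _ := mul_one _
    _ = 1 := PMF.tsum_coe _

end Transience

end

theorem theorem2 (p : PMF ℕ) (hm : 1 < offspringMean p) (hm' : offspringMean p < ∞)
    (δ : ℝ) (hδ : 0 < δ) :
    IsTransient (orrwOnGaltonWatson p δ) (fun k ω => ω.2 k) := by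
  unfold IsTransient
  have hS : MeasurableSet {ω : (List ℕ → ℕ) × (ℕ → List ℕ) | ∀ k, 1 ≤ k → ω.2 k ≠ ω.2 0} := by
    simp only [Set.ofPred_forall]
    refine MeasurableSet.iInter fun k => MeasurableSet.iInter fun _ => ?_
    exact (measurableSet_eq_fun ((measurable_pi_apply k).comp measurable_snd)
      ((measurable_pi_apply 0).comp measurable_snd)).compl
  rw [pos_iff_ne_zero]
  intro h0
  rw [orrwOnGaltonWatson, Measure.compProd_apply hS,
    lintegral_eq_zero_iff (Kernel.measurable_kernel_prodMk_left hS)] at h0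
  have h1 : ∀ᵐ N ∂(offspringLaw p), 1 ≤ edgeReturn δ N 1 := by
    filter_upwards [h0] with N hN
    by_contra! hlt
    refine (orrwLaw_return_lt_one hδ hlt).ne ?_
    have hT : MeasurableSet {x : ℕ → List ℕ | ∃ k, 1 ≤ k ∧ x k = x 0} := by
      simp only [Set.ofPred_exists, Set.ofPred_and]
      exact MeasurableSet.iUnion fun k => (MeasurableSet.const _).inter
        (measurableSet_eq_fun (measurable_pi_apply k) (measurable_pi_apply 0))
    rw [← prob_compl_eq_zero_iff hT]
    convert! hN using 2
    ext x
    simp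
  have h2 := lintegral_mono_ae h1
  rw [lintegral_const, measure_univ, mul_one] at h2
  exact (h2.trans_lt (lintegral_edgeReturn_le p hm hδ)).false
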